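/- **Definitions.** Write $[X]^{<\omega}$ for the set of finite subsets of $X$; for finite sets of ordinals, $A<B$ means that $a<b$ for all $a\in A$, $b\in B$, and $C\sqsubseteq D$ means that $C$ is an initial segment of $D$. * A *type* is a sequence $\tau=\{(m_k,n_{k+1},r_{k+1})\}_{k\in\omega}$ of triples of natural numbers with (a) $m_0=1$; (b) $n_k\ge 2$ for all $k\ge 1$; (c) for every $r\in\omega$ there are infinitely many $k\geq 1$ with $r_k=r$; (d) $m_k>r_{k+1}$ for all $k\in\omega$; (e) $m_{k+1}=r_{k+1}+(m_k-r_{k+1})n_{k+1}$ for all $k\in\omega$. A partition $\mathcal P$ of $\omega$ is *compatible with* $\tau$ if for all $P\in\mathcal P$ and $r\in\omega$ there are infinitely many $k\in P$, $k\ge1$, with $r_k=r$. * For a family $\mathcal F$ of finite sets, $\mathcal F_k$ is the set of elements of $\mathcal F$ of rank $k$ in the well-founded order $(\mathcal F,\subsetneq)$. $\mathcal F\subseteq[\omega_1]^{<\omega}$ is a *construction scheme over $\omega_1$ of type $\tau$* if (1) every finite subset of $\omega_1$ is contained in an element of $\mathcal F$; (2) $|F|=m_k$ for $F\in\mathcal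 F_k$; (3) $E\cap F\sqsubseteq E$ and $E\cap F\sqsubseteq F$ for $E,F\in\mathcal F_k$; (4) for every $k\in\omega$ and $F\in\mathcal F_{k+1}$ there are $F_0,\dots,F_{n_{k+1}-1}\in\mathcal F_k$, unique up to order, with $F=\bigcup_{i<n_{k+1}}F_i$; moreover, suitably ordered, they form a $\Delta$-system with a root $R(F)$ such that $|R(F)|=r_{k+1}$ and $R(F)<F_0\setminus R(F)<\dots<F_{n_{k+1}-1}\setminus R(F)$ (*the canonical decomposition of $F$*). * Let $l\ge1$. An element $F\in\mathcal F_l$ *fully captures* a finite family $\mathcal C\subseteq[\omega_1]^{<\omega}$ if $|\mathcal C|=n_l$ and $\mathcal C$ can be enumerated as $\{c_i\}_{i<n_l}$ so that for each $i<n_l$: $c_i\subseteq F_i$, $c_i\setminus R(F)\ne\emptyset$, and $\phi_i[c_0]=c_i$, where $\phi_i$ is the increasing bijection from $F_0$ to $F_i$. * Given a partition $\mathcal P$ of $\omega$, $\mathcal F$ is *$\mathcal P$-fully capturing* if for every uncountable $S\subseteq[\omega_1]^{<\omega}$, every $P\in\mathcal P$ and every $k\in\omega$ there are a finite $\mathcal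 C\subseteq S$, some $l\in P$ with $l>k$, and some $F\in\mathcal F_l$ which fully captures $\mathcal C$. It is *fully capturing* if this holds for $\mathcal P=\{\omega\}$. * *FCA*: for every type $\tau$ there is a fully capturing construction scheme over $\omega_1$ of type $\tau$. *FCA(part)*: for every type $\tau$ and every partition $\mathcal P$ of $\omega$ compatible with $\tau$ there is a $\mathcal P$-fully capturing construction scheme over $\omega_1$ of type $\tau$. * *$\Diamond$*: there is a sequence of sets $D_\alpha\subseteq\alpha$, indexed by the (nonzero) limit ordinals $\alpha<\omega_1$, such that for every $D\subseteq\omega_1$ the set of limit ordinals $\alpha<\omega_1$ with $D\cap\alpha=D_\alpha$ is stationary in $\omega_1$. **Theorem.** $\Diamond$ implies FCA, and $\Diamond$ implies FCA(part). -/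

import Mathlib

open scoped Ordinal

namespace ConstructionScheme

/-- A type: a sequence `(m_k, n_{k+1}, r_{k+1})`, `k ∈ ω`, of triples of natural numbers.
The values `n 0` and `r 0` play no role. -/
structure SchemeType where
  m : ℕ → ℕ
  n : ℕ → ℕ
  r : ℕ → ℕ
  m_zero : m 0 = 1
  two_le_n : ∀ k, 1 ≤ k → 2 ≤ n k
  r_infinite : ∀ s : ℕ, {k : ℕ | 1 ≤ k ∧ r k = s}.Infinite
  r_lt_m : ∀ k, r (k + 1) < m k
  m_succ : ∀ k, m (k + 1) = r (k + 1) + (m k - r (k + 1)) * n (k + 1)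

/-- A family `P` of subsets of `ω` is a partition of `ω` compatible with the type `τ`. -/
def CompatiblePartition (τ : SchemeType) (𝓟 : Set (Set ℕ)) : Prop :=
  Setoid.IsPartition 𝓟 ∧ ∀ P ∈ 𝓟, ∀ s : ℕ, {k : ℕ | k ∈ P ∧ 1 ≤ k ∧ τ.r k = s}.Infinite

/-- `𝓕_k`: the elements of `𝓕` of rank `k` in the well-founded order `(𝓕, ⊊)`. -/
def level (𝓕 : Set (Finset Ordinal.{0})) (k : ℕ) : Set (Finset Ordinal.{0}) :=
  {F | ∃ h : F ∈ 𝓕, IsWellFounded.rank (fun A B : 𝓕 => A.1 ⊂ B.1) ⟨F, h⟩ = k}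

/-- `C ⊑ D`: `C` is an initial segment of `D`. -/
def InitialSegment (C D : Finset Ordinal.{0}) : Prop :=
  C ⊆ D ∧ ∀ c ∈ C, ∀ d ∈ D, d ≤ c → d ∈ C

/-- `A < B`: every element of `A` is below every element of `B`. -/
def Before (A B : Finset Ordinal.{0}) : Prop :=
  ∀ a ∈ A, ∀ b ∈ B, a < b

/-- For `F ∈ 𝓕_{k+1}`: the sets `d 0, …, d (n_{k+1} - 1)` are elements of `𝓕_k` with union `F`
which form a `Δ`-system with root `R`, `|R| = r_{k+1}`, and
`R < d 0 \ R < ⋯ < d (n_{k+1} - 1) \ R`. -/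
structure IsCanonicalDecomposition (τ : SchemeType) (𝓕 : Set (Finset Ordinal.{0})) (k : ℕ)
    (F : Finset Ordinal.{0}) (d : ℕ → Finset Ordinal.{0}) (R : Finset Ordinal.{0}) : Prop where
  mem_level : ∀ i < τ.n (k + 1), d i ∈ level 𝓕 k
  union_eq : F = (Finset.range (τ.n (k + 1))).biUnion d
  injOn : Set.InjOn d (Set.Iio (τ.n (k + 1)))
  inter_eq : ∀ i < τ.n (k + 1), ∀ j < τ.n (k + 1), i ≠ j → d i ∩ d j = R
  card_root : R.card = τ.r (k + 1)
  root_before : Before R (d 0 \ R)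
  before : ∀ i j, i < j → j < τ.n (k + 1) → Before (d i \ R) (d j \ R)

/-- `𝓕` is a construction scheme over the set of ordinals `X` of type `τ`. -/
structure IsConstructionScheme (τ : SchemeType) (X : Set Ordinal.{0})
    (𝓕 : Set (Finset Ordinal.{0})) : Prop where
  subset : ∀ F ∈ 𝓕, (F : Set Ordinal.{0}) ⊆ X
  cofinal : ∀ A : Finset Ordinal.{0}, (A : Set Ordinal.{0}) ⊆ X → ∃ F ∈ 𝓕, A ⊆ F
  card_eq : ∀ k, ∀ F ∈ level 𝓕 k, F.card = τ.m k
  inter_initial : ∀ k, ∀ F ∈ level 𝓕 k, ∀ E ∈ level 𝓕 k,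
    InitialSegment (E ∩ F) E ∧ InitialSegment (E ∩ F) F
  /-- There is a canonical decomposition, and it is, up to the order in which its members are
  listed, the only way to write `F` as a union of `n_{k+1}` elements of `𝓕_k`. -/
  decomposition : ∀ k, ∀ F ∈ level 𝓕 (k + 1),
    ∃ d R, IsCanonicalDecomposition τ 𝓕 k F d R ∧
      ∀ e : ℕ → Finset Ordinal.{0}, (∀ i < τ.n (k + 1), e i ∈ level 𝓕 k) →
        F = (Finset.range (τ.n (k + 1))).biUnion e →
        (Finset.range (τ.n (k + 1))).image e = (Finset.range (τ.n (k + 1))).image d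

/-- `F ∈ 𝓕_l` captures the finite family `𝓒 = {c_i}_{i < |𝓒|}` of finite sets of ordinals. -/
def Captures (τ : SchemeType) (𝓕 : Set (Finset Ordinal.{0})) (l : ℕ) (F : Finset Ordinal.{0})
    (𝓒 : Finset (Finset Ordinal.{0})) : Prop :=
  F ∈ level 𝓕 l ∧ 𝓒.card ≤ τ.n l ∧
  ∃ (k : ℕ) (d : ℕ → Finset Ordinal.{0}) (R : Finset Ordinal.{0}) (c : ℕ → Finset Ordinal.{0}),
    l = k + 1 ∧ IsCanonicalDecomposition τ 𝓕 k F d R ∧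
    𝓒 = (Finset.range 𝓒.card).image c ∧
    ∀ i < 𝓒.card, c i ⊆ d i ∧ (c i \ R).Nonempty ∧
      -- the increasing bijection from `F_0` to `F_i` maps `c_0` onto `c_i`
      ∃ φ : Ordinal.{0} → Ordinal.{0}, StrictMonoOn φ (d 0) ∧ Set.BijOn φ (d 0) (d i) ∧
        (c 0).image φ = c i

/-- `F ∈ 𝓕_l` fully captures `𝓒`. -/
def FullyCaptures (τ : SchemeType) (𝓕 : Set (Finset Ordinal.{0})) (l : ℕ)
    (F : Finset Ordinal.{0}) (𝓒 : Finset (Finset Ordinal.{0})) : Prop :=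
  Captures τ 𝓕 l F 𝓒 ∧ τ.n l = 𝓒.card

/-- `𝓕` (a construction scheme over `ω₁` of type `τ`) is `𝓟`-fully capturing. -/
def IsPartitionFullyCapturing (τ : SchemeType) (𝓟 : Set (Set ℕ))
    (𝓕 : Set (Finset Ordinal.{0})) : Prop :=
  ∀ S : Set (Finset Ordinal.{0}), (∀ s ∈ S, (s : Set Ordinal.{0}) ⊆ Set.Iio ω₁) →
    ¬ S.Countable → ∀ P ∈ 𝓟, ∀ k : ℕ,
    ∃ 𝓒 : Finset (Finset Ordinal.{0}), (𝓒 : Set (Finset Ordinal.{0})) ⊆ S ∧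
      ∃ l ∈ P, k < l ∧ ∃ F ∈ level 𝓕 l, FullyCaptures τ 𝓕 l F 𝓒

/-- `𝓕` is fully capturing. -/
def IsFullyCapturing (τ : SchemeType) (𝓕 : Set (Finset Ordinal.{0})) : Prop :=
  IsPartitionFullyCapturing τ {Set.univ} 𝓕

/-- The Fully Capturing Axiom. -/
def FCA : Prop :=
  ∀ τ : SchemeType, ∃ 𝓕 : Set (Finset Ordinal.{0}),
    IsConstructionScheme τ (Set.Iio ω₁) 𝓕 ∧ IsFullyCapturing τ 𝓕

/-- The Fully Capturing Axiom with Partitions. -/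
def FCAPart : Prop :=
  ∀ (τ : SchemeType) (𝓟 : Set (Set ℕ)), CompatiblePartition τ 𝓟 →
    ∃ 𝓕 : Set (Finset Ordinal.{0}),
      IsConstructionScheme τ (Set.Iio ω₁) 𝓕 ∧ IsPartitionFullyCapturing τ 𝓟 𝓕

/-- `D` is a `◇`-sequence. Only the sets `D α` for limit ordinals `α < ω₁` are relevant, and
stationarity refers to the well-order `ω₁ = {α | α < ω₁}`. -/
def IsDiamondSequence (D : Ordinal.{0} → Set Ordinal.{0}) : Prop :=
  (∀ α < ω₁, Order.IsSuccLimit α → D α ⊆ Set.Iio α) ∧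
  ∀ E : Set Ordinal.{0}, E ⊆ Set.Iio ω₁ →
    IsStationary {α : Set.Iio (ω₁ : Ordinal.{0}) |
      Order.IsSuccLimit α.1 ∧ E ∩ Set.Iio α.1 = D α.1}

/-- Jensen's principle `◇`. -/
def Diamond : Prop := ∃ D : Ordinal.{0} → Set Ordinal.{0}, IsDiamondSequence D

end ConstructionScheme

/-! A set of level `k` is represented by its increasing enumeration on `Fin (τ.m k)`. The canonical
decomposition then becomes a fixed list of maps `piece`, and a scheme becomes a coherent family of
functions closed under them (`IsFamily`). Families over `ω * (1 + α)` are built by recursion on `α ≤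
ω₁`, starting from the scheme over `ω` generated by the initial segments. To pass from a limit `β`
to `β + ω`, one forces with countably many requirements: a condition is a function of the old
family, cut at some position and continued by `β, β + 1, …` (`splice`). The restrictions of a
generic sequence of conditions form the new family, which gains no function below `β`.

`◇`, applied to codes of finite sets, supplies at each limit `δ` a guess at an uncountable family
`T`. The recursion preserves `Guided`: any finite configuration reaching `δ` or higher is copied
into some piece `i` of some `f`, at a level prescribed by `P`, so that the root of `f` is the part
of that piece below `δ`. The corresponding sets in the earlier pieces lie in the guess. Moreover `i`
is maximal: unless the guess is already fully captured below `δ`, there is `η < δ` such that no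
function below `δ` with the same root, and above `η` beyond it, captures the pieces up to and
including `i`. The choice of a maximal `i` is made when `δ = β` (`exists_maximal_capture`) and
survives all later stages.

Given `T`, choose a limit `γ` where the guess is correct and which is closed under bounds for
witnesses (`exists_witness_bound`). A set `s ∈ T` not contained in `γ` is copied into piece `i` of
some `f`, so the pieces up to `i` all give members of `T`. Were `T` not fully captured below `γ`,
closure would reflect `f` to a function below `γ` that does the same, against the maximality of `i`.
-/

namespace ConstructionScheme

variable {τ : SchemeType}

/-! ### Canonical embeddings -/

theorem SchemeType.m_lt_m_succ (τ : SchemeType) (k : ℕ) : τ.m k < τ.m (k + 1) := by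
  have h1 := τ.r_lt_m k
  have h2 := Nat.mul_le_mul_left (τ.m k - τ.r (k + 1)) (τ.two_le_n (k + 1) (by omega))
  rw [τ.m_succ]
  omega

theorem SchemeType.m_strictMono (τ : SchemeType) : StrictMono τ.m :=
  strictMono_nat_of_lt_succ τ.m_lt_m_succ

theorem SchemeType.m_pos (τ : SchemeType) (k : ℕ) : 0 < τ.m k := by
  have := τ.m_strictMono.monotone (Nat.zero_le k)
  rw [τ.m_zero] at this
  omega

/-- The index of the first piece of a canonical decomposition. -/
def SchemeType.fst (τ : SchemeType) (k : ℕ) : Fin (τ.n (k + 1)) :=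
  ⟨0, by have := τ.two_le_n (k + 1) (by omega); omega⟩

/-- The index of the second piece of a canonical decomposition. -/
def SchemeType.snd (τ : SchemeType) (k : ℕ) : Fin (τ.n (k + 1)) :=
  ⟨1, by have := τ.two_le_n (k + 1) (by omega); omega⟩

theorem SchemeType.add_mul_lt (τ : SchemeType) {k i j : ℕ} (hi : i < τ.n (k + 1))
    (hj : j < τ.m k) : j + i * (τ.m k - τ.r (k + 1)) < τ.m (k + 1) := by
  have h1 := τ.r_lt_m k
  have h2 := Nat.mul_le_mul_left (τ.m k - τ.r (k + 1)) (Nat.succ_le_of_lt hi)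
  rw [τ.m_succ, mul_comm i]
  rw [Nat.mul_succ] at h2
  omega

/-- The increasing enumeration of the `i`-th piece of the canonical decomposition of
`τ.m (k + 1)`. -/
def piece (τ : SchemeType) (k : ℕ) (i : Fin (τ.n (k + 1))) (j : Fin (τ.m k)) :
    Fin (τ.m (k + 1)) :=
  ⟨if j.1 < τ.r (k + 1) then j.1 else j.1 + i.1 * (τ.m k - τ.r (k + 1)), by
    have := τ.add_mul_lt i.2 j.2
    split <;> omega⟩

theorem piece_val_of_lt {k : ℕ} (i : Fin (τ.n (k + 1))) {j : Fin (τ.m k)}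
    (h : j.1 < τ.r (k + 1)) : (piece τ k i j).1 = j.1 := by
  simp [piece, h]

theorem piece_val_of_le {k : ℕ} (i : Fin (τ.n (k + 1))) {j : Fin (τ.m k)}
    (h : τ.r (k + 1) ≤ j.1) :
    (piece τ k i j).1 = j.1 + i.1 * (τ.m k - τ.r (k + 1)) := by
  simp [piece, h]

theorem piece_fst_val {k : ℕ} (j : Fin (τ.m k)) : (piece τ k (τ.fst k) j).1 = j.1 := by
  simp [piece, SchemeType.fst]

theorem le_piece_val {k : ℕ} (i : Fin (τ.n (k + 1))) (j : Fin (τ.m k)) :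
    j.1 ≤ (piece τ k i j).1 := by
  simp only [piece]
  split <;> omega

theorem piece_val_lt_r_iff {k : ℕ} (i : Fin (τ.n (k + 1))) (j : Fin (τ.m k)) :
    (piece τ k i j).1 < τ.r (k + 1) ↔ j.1 < τ.r (k + 1) := by
  simp only [piece]
  split <;> omega

theorem piece_strictMono (k : ℕ) (i : Fin (τ.n (k + 1))) : StrictMono (piece τ k i) := by
  intro a b hab
  rw [Fin.lt_def] at hab ⊢
  simp only [piece]
  split <;> split <;> omega

theorem piece_lt_piece {k : ℕ} {i j : Fin (τ.n (k + 1))} (hij : i < j) (x : Fin (τ.m k))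
    {y : Fin (τ.m k)} (hy : τ.r (k + 1) ≤ y.1) : piece τ k i x < piece τ k j y := by
  have h1 := Nat.mul_le_mul_right (τ.m k - τ.r (k + 1)) (Nat.succ_le_of_lt (Fin.lt_def.1 hij))
  rw [Nat.succ_mul] at h1
  rw [Fin.lt_def, piece_val_of_le j hy]
  have h2 := τ.r_lt_m k
  simp only [piece]
  split <;> omega

theorem piece_eq_piece {k : ℕ} {i j : Fin (τ.n (k + 1))} {a b : Fin (τ.m k)}
    (h : piece τ k i a = piece τ k j b) : a = b ∧ (τ.r (k + 1) ≤ a.1 → i = j) := by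
  by_cases ha : a.1 < τ.r (k + 1)
  · refine ⟨?_, fun h' => absurd ha (by omega)⟩
    have hb := (piece_val_lt_r_iff j b).1 (h ▸ (piece_val_lt_r_iff i a).2 ha)
    have := congrArg Fin.val h
    rw [piece_val_of_lt i ha, piece_val_of_lt j hb] at this
    exact Fin.ext this
  · have hb : ¬ b.1 < τ.r (k + 1) := fun hb =>
      ha ((piece_val_lt_r_iff i a).1 (h ▸ (piece_val_lt_r_iff j b).2 hb))
    have hij : i = j := by
      rcases lt_trichotomy i j with h' | h' | h'
      · exact absurd h (piece_lt_piece h' a (by omega)).ne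
      · exact h'
      · exact absurd h (piece_lt_piece h' b (by omega)).ne'
    subst hij
    exact ⟨(piece_strictMono k i).injective h, fun _ => rfl⟩

theorem exists_piece_eq {k : ℕ} (y : Fin (τ.m (k + 1))) : ∃ i x, piece τ k i x = y := by
  have h1 := τ.r_lt_m k
  by_cases hy : y.1 < τ.r (k + 1)
  · exact ⟨τ.fst k, ⟨y.1, by omega⟩, Fin.ext (piece_fst_val _)⟩
  · have hD : 0 < τ.m k - τ.r (k + 1) := by omega
    have h2 := Nat.mod_add_div (y.1 - τ.r (k + 1)) (τ.m k - τ.r (k + 1))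
    have h3 := Nat.mod_lt (y.1 - τ.r (k + 1)) hD
    have h4 : (y.1 - τ.r (k + 1)) / (τ.m k - τ.r (k + 1)) < τ.n (k + 1) := by
      rw [Nat.div_lt_iff_lt_mul hD, mul_comm]
      have h5 := y.2
      have h6 := τ.m_succ k
      omega
    refine ⟨⟨_, h4⟩, ⟨τ.r (k + 1) + (y.1 - τ.r (k + 1)) % (τ.m k - τ.r (k + 1)), by omega⟩, ?_⟩
    apply Fin.ext
    rw [piece_val_of_le _ (by simp), mul_comm]
    simp only
    omega

/-- Compositions of canonical piece embeddings. -/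
inductive Emb (τ : SchemeType) : ∀ {l k : ℕ}, (Fin (τ.m l) → Fin (τ.m k)) → Prop
  | refl (k : ℕ) : Emb τ (id : Fin (τ.m k) → Fin (τ.m k))
  | step {l k : ℕ} {φ : Fin (τ.m (l + 1)) → Fin (τ.m k)} (i : Fin (τ.n (l + 1))) :
      Emb τ φ → Emb τ (φ ∘ piece τ l i)

theorem Emb.piece {k : ℕ} (i : Fin (τ.n (k + 1))) : Emb τ (piece τ k i) :=
  Emb.step i (Emb.refl (k + 1))

theorem Emb.strictMono {l k : ℕ} {φ : Fin (τ.m l) → Fin (τ.m k)} (h : Emb τ φ) :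
    StrictMono φ := by
  induction h with
  | refl k => exact strictMono_id
  | step i _ ih => exact ih.comp (piece_strictMono _ i)

theorem Emb.comp {l k j : ℕ} {φ : Fin (τ.m l) → Fin (τ.m k)} {ψ : Fin (τ.m k) → Fin (τ.m j)}
    (hψ : Emb τ ψ) (hφ : Emb τ φ) : Emb τ (ψ ∘ φ) := by
  induction hφ with
  | refl k => exact hψ
  | step i _ ih => exact Emb.step i (ih hψ)

theorem Emb.exists_apply_eq {l k : ℕ} (h : l ≤ k) (y : Fin (τ.m k)) :
    ∃ φ : Fin (τ.m l) → Fin (τ.m k), Emb τ φ ∧ ∃ x, φ x = y := by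
  induction h using Nat.decreasingInduction with
  | self => exact ⟨id, Emb.refl k, y, rfl⟩
  | of_succ l _ ih =>
    obtain ⟨φ, hφ, x, rfl⟩ := ih
    obtain ⟨i, x, rfl⟩ := exists_piece_eq x
    exact ⟨_, hφ.step i, x, rfl⟩

/-- `φ` is a translation from `a` on. -/
def Translates {m n : ℕ} (φ : Fin m → Fin n) (a : Fin m) : Prop :=
  ∀ j, a ≤ j → (φ j).1 = (φ a).1 + (j.1 - a.1)

theorem Translates.mono {m n : ℕ} {φ : Fin m → Fin n} {a b : Fin m} (h : Translates φ a)
    (hab : a ≤ b) : Translates φ b := by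
  intro j hj
  have h1 := h j (hab.trans hj)
  have h2 := h b hab
  rw [Fin.le_def] at hab hj
  omega

theorem Translates.comp {m n p : ℕ} {φ : Fin m → Fin n} {ψ : Fin n → Fin p} {a : Fin m}
    (hψ : Translates ψ (φ a)) (hφ : Translates φ a) : Translates (ψ ∘ φ) a := by
  intro j hj
  have h1 := hφ j hj
  have h2 := hψ (φ j) (by rw [Fin.le_def]; omega)
  simp only [Function.comp]
  omega

theorem translates_piece {k : ℕ} (i : Fin (τ.n (k + 1))) {a : Fin (τ.m k)}
    (ha : τ.r (k + 1) ≤ a.1) : Translates (piece τ k i) a := by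
  intro j hj
  rw [Fin.le_def] at hj
  rw [piece_val_of_le i ha, piece_val_of_le i (ha.trans hj)]
  omega

theorem translates_piece_fst {k : ℕ} (a : Fin (τ.m k)) :
    Translates (piece τ k (τ.fst k)) a := by
  intro j hj
  rw [Fin.le_def] at hj
  rw [piece_fst_val, piece_fst_val]
  omega

/-- Past its root a piece is already a translation. If `a` falls inside the root, all pieces agree
up to `a`, so the piece may be exchanged for the first one, which preserves values. -/
theorem Emb.exists_translates {l k : ℕ} {φ : Fin (τ.m l) → Fin (τ.m k)} (h : Emb τ φ)
    (a : Fin (τ.m l)) : ∃ φ' : Fin (τ.m l) → Fin (τ.m k), Emb τ φ' ∧ Translates φ' a ∧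
      ∀ x ≤ a, φ' x = φ x := by
  induction h with
  | refl k => exact ⟨id, Emb.refl k, fun j hj => by rw [Fin.le_def] at hj; simp; omega,
      fun _ _ => rfl⟩
  | @step l k φ i _ ih =>
    obtain ⟨ψ, hψ, hT, heq⟩ := ih (ConstructionScheme.piece τ l i a)
    by_cases ha : a.1 < τ.r (l + 1)
    · have key : ∀ x ≤ a, ConstructionScheme.piece τ l (τ.fst l) x =
          ConstructionScheme.piece τ l i x := fun x hx => by
        apply Fin.ext
        rw [Fin.le_def] at hx
        rw [piece_fst_val, piece_val_of_lt i (by omega)]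
      refine ⟨_, hψ.step (τ.fst l), Translates.comp ?_ (translates_piece_fst a), ?_⟩
      · rwa [key a le_rfl]
      · intro x hx
        simp only [Function.comp]
        rw [key x hx]
        exact heq _ ((piece_strictMono l i).monotone hx)
    · exact ⟨_, hψ.step i, hT.comp (translates_piece i (by omega)),
        fun x hx => heq _ ((piece_strictMono l i).monotone hx)⟩

theorem Emb.le {l k : ℕ} {φ : Fin (τ.m l) → Fin (τ.m k)} (h : Emb τ φ) : l ≤ k := by
  induction h with
  | refl k => exact le_rfl
  | step i _ ih => omega

theorem Emb.val_eq_of_eq {l k : ℕ} {φ : Fin (τ.m l) → Fin (τ.m k)} (h : Emb τ φ) (hlk : l = k)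
    (x : Fin (τ.m l)) : (φ x).1 = x.1 := by
  cases h with
  | refl => rfl
  | step i h => exact absurd (hlk ▸ h.le) (Nat.not_succ_le_self _)

/-- Distinct pieces meet only in the root, where both are the identity on values; this passes
through compositions. It is the source of the initial-segment axiom of a scheme. -/
theorem Emb.coherent {l k : ℕ} {φ ψ : Fin (τ.m l) → Fin (τ.m k)} (hφ : Emb τ φ) (hψ : Emb τ ψ)
    {a b : Fin (τ.m l)} (hab : φ a = ψ b) : a = b ∧ ∀ c ≤ a, φ c = ψ c := by
  induction hφ with
  | refl k =>
    have hx : ∀ x, ψ x = x := fun x => Fin.ext (hψ.val_eq_of_eq rfl x)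
    exact ⟨by simpa [hx] using hab, fun c _ => (hx c).symm⟩
  | @step l k φ i hφ ih =>
    cases hψ with
    | refl => exact absurd hφ.le (Nat.not_succ_le_self l)
    | @step _ _ ψ j hψ =>
      obtain ⟨h1, h2⟩ := ih hψ hab
      obtain ⟨h3, h4⟩ := piece_eq_piece h1
      refine ⟨h3, fun c hc => ?_⟩
      have h5 := h2 _ ((piece_strictMono l i).monotone hc)
      simp only [Function.comp]
      rw [h5]
      congr 1
      by_cases ha : τ.r (l + 1) ≤ a.1
      · rw [h4 ha]
      · rw [Fin.le_def] at hc
        apply Fin.ext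
        rw [piece_val_of_lt i (by omega), piece_val_of_lt j (by omega)]

/-! ### Families of increasing functions -/

/-- A construction scheme over the ordinal `β`, with the elements of each level represented by their
increasing enumerations. -/
structure IsFamily (τ : SchemeType) (L : ∀ k, Set (Fin (τ.m k) → Ordinal.{0}))
    (β : Ordinal.{0}) : Prop where
  strictMono : ∀ {k}, ∀ f ∈ L k, StrictMono f
  lt : ∀ {k}, ∀ f ∈ L k, ∀ x, f x < β
  cover : ∀ A : Finset Ordinal.{0}, (∀ x ∈ A, x < β) → ∃ k, ∃ f ∈ L k, ∀ x ∈ A, ∃ j, f j = x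
  coherent : ∀ {k}, ∀ f ∈ L k, ∀ g ∈ L k, ∀ a b, f a = g b → a = b ∧ ∀ c ≤ a, f c = g c
  closed : ∀ {k}, ∀ f ∈ L (k + 1), ∀ i, f ∘ piece τ k i ∈ L k

namespace IsFamily

variable {L : ∀ k, Set (Fin (τ.m k) → Ordinal.{0})} {β : Ordinal.{0}}

theorem comp_mem (hL : IsFamily τ L β) {l k : ℕ} {φ : Fin (τ.m l) → Fin (τ.m k)}
    (hφ : Emb τ φ) {f : Fin (τ.m k) → Ordinal.{0}} (hf : f ∈ L k) : f ∘ φ ∈ L l := by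
  induction hφ with
  | refl k => exact hf
  | step i _ ih => exact hL.closed _ (ih hf) i

theorem le_of_forall_exists (hL : IsFamily τ L β) {l k : ℕ} {h : Fin (τ.m l) → Ordinal.{0}}
    (hh : h ∈ L l) {f : Fin (τ.m k) → Ordinal.{0}} (H : ∀ x, ∃ j, f j = h x) : l ≤ k := by
  choose g hg using H
  have hg' : Function.Injective g := fun x y hxy =>
    (hL.strictMono h hh).injective (by rw [← hg, ← hg, hxy])
  have := Fintype.card_le_of_injective g hg'
  simp only [Fintype.card_fin] at this
  exact τ.m_strictMono.le_iff_le.1 this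

/-- Some canonical embedding has `y` in its range, and coherence at this single point identifies the
two functions below it. -/
theorem exists_emb_of_eq (hL : IsFamily τ L β) {l k : ℕ} (hlk : l ≤ k)
    {h : Fin (τ.m l) → Ordinal.{0}} (hh : h ∈ L l) {f : Fin (τ.m k) → Ordinal.{0}} (hf : f ∈ L k)
    {y : Fin (τ.m k)} {a : Fin (τ.m l)} (hy : f y = h a) :
    ∃ φ : Fin (τ.m l) → Fin (τ.m k), Emb τ φ ∧ φ a = y ∧ ∀ c ≤ a, f (φ c) = h c := by
  obtain ⟨φ, hφ, x, rfl⟩ := Emb.exists_apply_eq hlk y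
  obtain ⟨rfl, h2⟩ := hL.coherent _ (hL.comp_mem hφ hf) h hh x a hy
  exact ⟨φ, hφ, rfl, h2⟩

theorem exists_emb (hL : IsFamily τ L β) {l k : ℕ}
    {h : Fin (τ.m l) → Ordinal.{0}} (hh : h ∈ L l) {f : Fin (τ.m k) → Ordinal.{0}} (hf : f ∈ L k)
    (H : ∀ x, ∃ j, f j = h x) :
    ∃ φ : Fin (τ.m l) → Fin (τ.m k), Emb τ φ ∧ ∀ c, f (φ c) = h c := by
  have hpos := τ.m_pos l
  obtain ⟨y, hy⟩ := H ⟨τ.m l - 1, by omega⟩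
  obtain ⟨φ, hφ, -, h2⟩ := hL.exists_emb_of_eq (hL.le_of_forall_exists hh H) hh hf hy
  exact ⟨φ, hφ, fun c => h2 c (by have := c.2; rw [Fin.le_def]; simp; omega)⟩

end IsFamily

/-- The functions obtained by restricting members of `G` along canonical embeddings. -/
def restrictions (τ : SchemeType) (G : Set (Σ l, Fin (τ.m l) → Ordinal.{0})) (k : ℕ) :
    Set (Fin (τ.m k) → Ordinal.{0}) :=
  {h | ∃ c ∈ G, ∃ φ : Fin (τ.m k) → Fin (τ.m c.1), Emb τ φ ∧ h = c.2 ∘ φ}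

/-- `c` is a restriction of `c'` along a canonical embedding. -/
def Extends {τ : SchemeType} (c c' : Σ l, Fin (τ.m l) → Ordinal.{0}) : Prop :=
  ∃ ψ : Fin (τ.m c.1) → Fin (τ.m c'.1), Emb τ ψ ∧ c'.2 ∘ ψ = c.2

theorem Extends.refl (c : Σ l, Fin (τ.m l) → Ordinal.{0}) : Extends c c :=
  ⟨id, Emb.refl _, rfl⟩

theorem Extends.trans {c c' c'' : Σ l, Fin (τ.m l) → Ordinal.{0}} (h : Extends c c')
    (h' : Extends c' c'') : Extends c c'' := by
  obtain ⟨ψ, hψ, h1⟩ := h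
  obtain ⟨χ, hχ, h2⟩ := h'
  exact ⟨χ ∘ ψ, hχ.comp hψ, by rw [← h1, ← h2]; rfl⟩

/-- Directedness places two restrictions inside one member of `G`, where coherence reduces to that
of canonical embeddings. -/
theorem isFamily_restrictions {G : Set (Σ l, Fin (τ.m l) → Ordinal.{0})} {β : Ordinal.{0}}
    (hmono : ∀ c ∈ G, StrictMono c.2) (hlt : ∀ c ∈ G, ∀ x, c.2 x < β)
    (hdir : ∀ c ∈ G, ∀ c' ∈ G, ∃ c'' ∈ G, Extends c c'' ∧ Extends c' c'')
    (hcover : ∀ A : Finset Ordinal.{0}, (∀ x ∈ A, x < β) → ∃ c ∈ G, ∀ x ∈ A, ∃ j, c.2 j = x) :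
    IsFamily τ (restrictions τ G) β where
  strictMono := by
    rintro k _ ⟨c, hc, φ, hφ, rfl⟩
    exact (hmono c hc).comp hφ.strictMono
  lt := by
    rintro k _ ⟨c, hc, φ, hφ, rfl⟩ x
    exact hlt c hc _
  cover A hA := by
    obtain ⟨c, hc, h⟩ := hcover A hA
    exact ⟨c.1, c.2, ⟨c, hc, id, Emb.refl _, rfl⟩, h⟩
  coherent := by
    rintro k _ ⟨c, hc, φ, hφ, rfl⟩ _ ⟨c', hc', φ', hφ', rfl⟩ a b hab
    obtain ⟨c'', hc'', ⟨ψ, hψ, h1⟩, ⟨ψ', hψ', h2⟩⟩ := hdir c hc c' hc'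
    rw [← h1, ← h2] at hab ⊢
    obtain ⟨h3, h4⟩ := (hψ.comp hφ).coherent (hψ'.comp hφ') ((hmono c'' hc'').injective hab)
    exact ⟨h3, fun x hx => congrArg c''.2 (h4 x hx)⟩
  closed := by
    rintro k _ ⟨c, hc, φ, hφ, rfl⟩ i
    exact ⟨c, hc, _, hφ.step i, rfl⟩

/-! ### Splicing -/

/-- The function which follows `f` below `a` and enumerates `β, β + 1, …` from `a` on. -/
noncomputable def splice {m : ℕ} (β : Ordinal.{0}) (f : Fin m → Ordinal.{0}) (a : Fin m) :
    Fin m → Ordinal.{0} :=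
  fun j => if j < a then f j else β + ((j.1 - a.1 : ℕ) : Ordinal.{0})

section Splice

variable {m n : ℕ} {β : Ordinal.{0}} {f g : Fin m → Ordinal.{0}} {a j : Fin m}

theorem splice_of_lt (h : j < a) : splice β f a j = f j := by
  simp [splice, h]

theorem splice_of_le (h : a ≤ j) :
    splice β f a j = β + ((j.1 - a.1 : ℕ) : Ordinal.{0}) := by
  simp [splice, h.not_gt]

theorem le_splice (h : a ≤ j) : β ≤ splice β f a j := by
  rw [splice_of_le h]
  exact le_self_add

theorem lt_of_splice_lt (h : splice β f a j < β) : j < a :=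
  lt_of_not_ge fun h' => (le_splice h').not_gt h

theorem splice_congr (h : ∀ x < a, f x = g x) : splice β f a = splice β g a := by
  funext j
  by_cases hj : j < a
  · rw [splice_of_lt hj, splice_of_lt hj, h j hj]
  · rw [splice_of_le (not_lt.1 hj), splice_of_le (not_lt.1 hj)]

/-- A translation keeps the tail `β, β + 1, …` free of gaps, so that cutting commutes with
restriction. `Translates` is carried along for this purpose. -/
theorem splice_comp {χ : Fin n → Fin m} {a : Fin n} (hχ : StrictMono χ) (hT : Translates χ a) :
    splice β f (χ a) ∘ χ = splice β (f ∘ χ) a := by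
  funext j
  simp only [Function.comp]
  by_cases hj : j < a
  · rw [splice_of_lt hj, splice_of_lt (hχ hj)]
    rfl
  · have hj := not_lt.1 hj
    rw [splice_of_le hj, splice_of_le (hχ.monotone hj), hT j hj]
    simp

theorem strictMono_splice (hf : StrictMono f) (hlt : ∀ x, f x < β) :
    StrictMono (splice β f a) := by
  intro x y hxy
  by_cases hy : y < a
  · rw [splice_of_lt hy, splice_of_lt (hxy.trans hy)]
    exact hf hxy
  · by_cases hx : x < a
    · rw [splice_of_lt hx]
      exact (hlt x).trans_le (le_splice (not_lt.1 hy))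
    · rw [splice_of_le (not_lt.1 hx), splice_of_le (not_lt.1 hy)]
      rw [not_lt, Fin.le_def] at hx
      rw [Fin.lt_def] at hxy
      gcongr

theorem splice_lt (hlt : ∀ x, f x < β) : splice β f a j < β + ω := by
  by_cases hj : j < a
  · rw [splice_of_lt hj]
    exact (hlt j).trans_le le_self_add
  · rw [splice_of_le (not_lt.1 hj)]
    gcongr
    exact Ordinal.natCast_lt_omega0 _

/-- A strictly increasing function has no room for further values between consecutive ordinals, so
these occupy consecutive positions. -/
theorem exists_eq_add_of_forall (hf : StrictMono f) {N : ℕ}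
    (h : ∀ t : ℕ, t ≤ N → ∃ j, f j = f a + (t : Ordinal.{0})) :
    ∃ j : Fin m, j.1 = a.1 + N ∧ f j = f a + (N : Ordinal.{0}) := by
  induction N with
  | zero => exact ⟨a, rfl, by simp⟩
  | succ N ih =>
    obtain ⟨j, hj, hfj⟩ := ih fun t ht => h t (by omega)
    obtain ⟨j', hj'⟩ := h (N + 1) le_rfl
    have h1 : f j < f j' := by
      rw [hfj, hj']
      gcongr
      exact Nat.lt_succ_self N
    have h2 : j.1 + 1 ≤ j'.1 := Fin.lt_def.1 (hf.lt_iff_lt.1 h1)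
    refine ⟨⟨a.1 + (N + 1), by have := j'.2; omega⟩, rfl, le_antisymm ?_ ?_⟩
    · rw [← hj']
      apply hf.monotone
      rw [Fin.le_def]
      simp only
      omega
    · have h3 : f j < f ⟨a.1 + (N + 1), by have := j'.2; omega⟩ := by
        apply hf
        rw [Fin.lt_def]
        simp only
        omega
      rw [Nat.cast_succ, ← add_assoc, ← hfj]
      exact Order.add_one_le_of_lt h3

end Splice

theorem exists_nat_bound {β : Ordinal.{0}} (A : Finset Ordinal.{0}) (hA : ∀ x ∈ A, x < β + ω) :
    ∃ N : ℕ, ∀ x ∈ A, β ≤ x → ∃ n : ℕ, n ≤ N ∧ x = β + (n : Ordinal.{0}) := by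
  have h : ∀ x ∈ A, ∃ n : ℕ, β ≤ x → x = β + (n : Ordinal.{0}) := by
    intro x hx
    by_cases hβ : β ≤ x
    · obtain ⟨y, rfl⟩ := exists_add_of_le hβ
      obtain ⟨n, rfl⟩ := Ordinal.lt_omega0.1 (lt_of_add_lt_add_left (hA _ hx))
      exact ⟨n, fun _ => rfl⟩
    · exact ⟨0, fun h => absurd h hβ⟩
  choose! g hg using h
  exact ⟨A.sup g, fun x hx hβ => ⟨g x, Finset.le_sup hx, hg x hx hβ⟩⟩

/-! ### Guided families -/

/-- Relative to a guess `S` of a family of finite sets: the sets at the positions `p` in the pieces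
of `f` before the `i`-th one are in `S`, and either `S` is fully captured below `δ`, or no function
below `δ` which agrees with `f` on the root, and lies above some `η < δ` beyond it, does better. -/
def Captured (L : ∀ k, Set (Fin (τ.m k) → Ordinal.{0})) (δ : Ordinal.{0})
    (S : Set (Finset Ordinal.{0})) {k : ℕ} (f : Fin (τ.m (k + 1)) → Ordinal.{0})
    (i : Fin (τ.n (k + 1))) (p : Finset (Fin (τ.m k))) : Prop :=
  (∀ j < i, p.image (f ∘ piece τ k j) ∈ S) ∧
  ((∃ g ∈ L (k + 1), (∀ x, g x < δ) ∧ ∀ j, p.image (g ∘ piece τ k j) ∈ S) ∨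
    ∃ η, (δ ≠ 0 → η < δ) ∧ (∀ x : Fin (τ.m (k + 1)), τ.r (k + 1) ≤ x.1 → η ≤ f x) ∧
      ¬ ∃ g ∈ L (k + 1), (∀ x, g x < δ) ∧
        (∀ x : Fin (τ.m (k + 1)), x.1 < τ.r (k + 1) → g x = f x) ∧
        (∀ x : Fin (τ.m (k + 1)), τ.r (k + 1) ≤ x.1 → η ≤ g x) ∧
        ∀ j ≤ i, p.image (g ∘ piece τ k j) ∈ S)

/-- Some piece of `f` contains `A`, has root the part of it below `δ`, and extends `h` up to `a`. -/
def GuidedBy (L : ∀ k, Set (Fin (τ.m k) → Ordinal.{0})) (δ : Ordinal.{0})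
    (S : Set (Finset Ordinal.{0})) (A : Finset Ordinal.{0}) {l : ℕ}
    (h : Fin (τ.m l) → Ordinal.{0}) (a : Fin (τ.m l)) (q : Finset (Fin (τ.m l)))
    {k : ℕ} (f : Fin (τ.m (k + 1)) → Ordinal.{0}) : Prop :=
  ∃ φ : Fin (τ.m l) → Fin (τ.m k), Emb τ φ ∧ Translates φ a ∧ ∃ i,
    (∀ x ≤ a, f (piece τ k i (φ x)) = h x) ∧ (∀ x ∈ A, ∃ j, f (piece τ k i j) = x) ∧
    (∀ j, f (piece τ k i j) < δ ↔ j.1 < τ.r (k + 1)) ∧ Captured L δ S f i (q.image φ)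

/-- The induction hypothesis of the recursive construction of the scheme. -/
def Guided (𝓟 : Set (Set ℕ)) (S : Bool → Ordinal.{0} → Set (Finset Ordinal.{0}))
    (L : ∀ k, Set (Fin (τ.m k) → Ordinal.{0})) (β : Ordinal.{0}) : Prop :=
  ∀ δ < β, ∀ b, ∀ P ∈ 𝓟, ∀ A : Finset Ordinal.{0}, (∀ x ∈ A, x < β) →
    ∀ l, ∀ h ∈ L l, ∀ a, δ ≤ h a → ∀ q : Finset (Fin (τ.m l)),
      ∃ k, k + 1 ∈ P ∧ ∃ f ∈ L (k + 1), GuidedBy L δ (S b δ) A h a q f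

/-- The conditions of the forcing which extends the scheme `L` from `β` to `β + ω`. -/
def IsCond (L : ∀ k, Set (Fin (τ.m k) → Ordinal.{0})) (β : Ordinal.{0})
    (c : Σ l, Fin (τ.m l) → Ordinal.{0}) : Prop :=
  ∃ f ∈ L c.1, ∃ a, c.2 = splice β f a

/-! ### Density arguments for one stage of the forcing -/

section Stage

variable {𝓟 : Set (Set ℕ)} {S : Bool → Ordinal.{0} → Set (Finset Ordinal.{0})}
  {L : ∀ k, Set (Fin (τ.m k) → Ordinal.{0})} {β : Ordinal.{0}}

/-- When the guess is empty no earlier piece can be captured, which forces `i` to be the first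
piece. The Boolean index of `S` exists to make the empty guess available at every `δ`. -/
theorem Guided.exists_root (hL : IsFamily τ L β) (hG : Guided 𝓟 S L β)
    (hS : ∀ δ, S false δ = ∅) {δ : Ordinal.{0}} (hδ : δ < β) {P : Set ℕ} (hP : P ∈ 𝓟)
    (A : Finset Ordinal.{0}) (hA : ∀ x ∈ A, x < β) :
    ∃ k, k + 1 ∈ P ∧ ∃ f ∈ L (k + 1), (∀ x ∈ A, ∃ j, f (piece τ k (τ.fst k) j) = x) ∧
      ∀ j, f (piece τ k (τ.fst k) j) < δ ↔ j.1 < τ.r (k + 1) := by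
  obtain ⟨l, h, hh, H⟩ := hL.cover {δ} (by simpa using hδ)
  obtain ⟨a, ha⟩ := H δ (by simp)
  obtain ⟨k, hk, f, hf, φ, -, -, i, -, h1, h2, h3, -⟩ :=
    hG δ hδ false P hP A hA l h hh a ha.ge ∅
  have hi : i = τ.fst k := by
    by_contra hi
    have := h3 (τ.fst k) (lt_of_le_of_ne (Fin.le_def.2 (Nat.zero_le _)) (Ne.symm hi))
    simp [hS] at this
  subst hi
  exact ⟨k, hk, f, hf, h1, h2⟩

/-- A function of `L` whose first piece extends `f₀`, together with its relation to `f₀`. -/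
theorem Guided.exists_root_emb (hL : IsFamily τ L β) (hG : Guided 𝓟 S L β)
    (hS : ∀ δ, S false δ = ∅) (hβ : Order.IsSuccLimit β) {P : Set ℕ} (hP : P ∈ 𝓟)
    (A : Finset Ordinal.{0}) (hA : ∀ x ∈ A, x < β) {l : ℕ} {f₀ : Fin (τ.m l) → Ordinal.{0}}
    (hf₀ : f₀ ∈ L l) (a₀ : Fin (τ.m l)) (s N : ℕ) (hsN : s ≤ N) :
    ∃ k, k + 1 ∈ P ∧ ∃ f ∈ L (k + 1), (∀ x ∈ A, ∃ j, f (piece τ k (τ.fst k) j) = x) ∧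
      ∃ χ : Fin (τ.m l) → Fin (τ.m k), Emb τ χ ∧ Translates χ a₀ ∧
        splice β (f ∘ piece τ k (τ.fst k)) (χ a₀) ∘ χ = splice β f₀ a₀ ∧
        (χ a₀).1 + s = τ.r (k + 1) ∧ (χ a₀).1 + N < τ.m k := by
  have hadd : ∀ x < β, ∀ t : ℕ, x + (t : Ordinal.{0}) < β := by
    intro x hx t
    induction t with
    | zero => simpa using hx
    | succ t ih =>
      rw [Nat.cast_succ, ← add_assoc]
      exact hβ.succ_lt ih
  have hf₀lt := hL.lt f₀ hf₀
  -- The value `f₀ a₀` stands in for `β`, so `f₀ a₀ + s` stands in for the intended end `β + s` of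
  -- the root. Including all `f₀ a₀ + t` with `t ≤ N` makes their positions consecutive, whence the
  -- root has size `χ a₀ + s`.
  obtain ⟨k, hk, f, hf, h1, h2⟩ := hG.exists_root hL hS (hadd _ (hf₀lt a₀) s) hP
    (A ∪ (Finset.univ.image f₀ ∪ (Finset.range (N + 1)).image
      fun t : ℕ => f₀ a₀ + (t : Ordinal.{0}))) (by
      intro x hx
      simp only [Finset.mem_union, Finset.mem_image, Finset.mem_univ, true_and] at hx
      rcases hx with hx | ⟨j, rfl⟩ | ⟨t, -, rfl⟩
      · exact hA x hx
      · exact hf₀lt j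
      · exact hadd _ (hf₀lt a₀) t)
  have hf' := hL.closed f hf (τ.fst k)
  have hmono := hL.strictMono _ hf'
  obtain ⟨χ₀, hχ₀, hχf₀⟩ := hL.exists_emb hf₀ hf' fun x => h1 (f₀ x) (by simp)
  obtain ⟨χ, hχ, hT, hχeq⟩ := hχ₀.exists_translates a₀
  have hχf : ∀ x ≤ a₀, f (piece τ k (τ.fst k) (χ x)) = f₀ x := fun x hx => by
    rw [hχeq x hx]; exact hχf₀ x
  have hcons : ∀ M ≤ N, ∃ j : Fin (τ.m k), j.1 = (χ a₀).1 + M ∧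
      (f ∘ piece τ k (τ.fst k)) j = f₀ a₀ + (M : Ordinal.{0}) := by
    intro M hM
    have := exists_eq_add_of_forall (a := χ a₀) hmono (N := M) fun t ht => by
      obtain ⟨j, hj⟩ := h1 (f₀ a₀ + (t : Ordinal.{0})) (by
        simp only [Finset.mem_union, Finset.mem_image, Finset.mem_range]
        exact Or.inr (Or.inr ⟨t, by omega, rfl⟩))
      exact ⟨j, by simp only [Function.comp]; rw [hj, hχf _ le_rfl]⟩
    rwa [show (f ∘ piece τ k (τ.fst k)) (χ a₀) = f₀ a₀ from hχf _ le_rfl] at this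
  refine ⟨k, hk, f, hf, fun x hx => h1 x (by simp [hx]), χ, hχ, hT, ?_, ?_, ?_⟩
  · rw [splice_comp hχ.strictMono hT]
    exact splice_congr fun x hx => hχf x hx.le
  · obtain ⟨j, hj, hj'⟩ := hcons s hsN
    have h3 : ∀ x : Fin (τ.m k), x < j ↔ x.1 < τ.r (k + 1) := fun x => by
      rw [← h2 x, ← hj']
      exact hmono.lt_iff_lt.symm
    have h4 := τ.r_lt_m k
    have h5 := h3 j
    have h6 := h3 ⟨τ.r (k + 1), h4⟩
    simp only [lt_irrefl, false_iff, iff_false, Fin.lt_def] at h5 h6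
    omega
  · obtain ⟨j, hj, -⟩ := hcons N le_rfl
    omega

/-- The root is made to end exactly at the cut. The first piece of `f` stays below `β` and contains
the old points of `A`; the second piece is cut right after the root and takes the values `β, …, β +
N`. -/
theorem exists_extends_cover (hL : IsFamily τ L β) (hG : Guided 𝓟 S L β)
    (hS : ∀ δ, S false δ = ∅) (hβ : Order.IsSuccLimit β) (h𝓟 : 𝓟.Nonempty)
    {c : Σ l, Fin (τ.m l) → Ordinal.{0}} (hc : IsCond L β c) (A : Finset Ordinal.{0})
    (hA : ∀ x ∈ A, x < β + ω) :
    ∃ c', IsCond L β c' ∧ Extends c c' ∧ ∀ x ∈ A, ∃ j, c'.2 j = x := by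
  obtain ⟨P, hP⟩ := h𝓟
  obtain ⟨l, c⟩ := c
  change ∃ f ∈ L l, ∃ a, c = splice β f a at hc
  obtain ⟨f₀, hf₀, a₀, rfl⟩ := hc
  obtain ⟨N, hN⟩ := exists_nat_bound A hA
  obtain ⟨k, -, f, hf, h1, χ, hχ, hT, hsp, hr, hm⟩ := hG.exists_root_emb hL hS hβ hP
    (A.filter (· < β)) (by simp) hf₀ a₀ 0 N (Nat.zero_le _)
  have hra : τ.r (k + 1) ≤ (χ a₀).1 := by omega
  have hG' : splice β f (piece τ k (τ.snd k) (χ a₀)) ∘ piece τ k (τ.snd k) =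
      splice β (f ∘ piece τ k (τ.fst k)) (χ a₀) := by
    rw [splice_comp (piece_strictMono _ _) (translates_piece _ hra)]
    refine splice_congr fun x hx => congrArg f (Fin.ext ?_)
    rw [Fin.lt_def] at hx
    rw [piece_val_of_lt _ (by omega), piece_fst_val]
  refine ⟨⟨k + 1, splice β f (piece τ k (τ.snd k) (χ a₀))⟩, ⟨f, hf, _, rfl⟩,
    ⟨piece τ k (τ.snd k) ∘ χ, (Emb.piece _).comp hχ, ?_⟩, fun x hx => ?_⟩
  · rw [← hsp, ← hG']
    rfl
  · by_cases hxβ : x < β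
    · obtain ⟨j, rfl⟩ := h1 x (by simp [hx, hxβ])
      refine ⟨piece τ k (τ.fst k) j, splice_of_lt (piece_lt_piece ?_ j hra)⟩
      simp [SchemeType.fst, SchemeType.snd, Fin.lt_def]
    · obtain ⟨n, hn, rfl⟩ := hN x hx (not_lt.1 hxβ)
      refine ⟨piece τ k (τ.snd k) ⟨(χ a₀).1 + n, by omega⟩, ?_⟩
      refine (congrFun hG' _).trans ?_
      rw [splice_of_le (by simp [Fin.le_def])]
      simp

/-- `Guided` is applied to the uncut function `f₀`, and the result is cut in its `i`-th piece beyond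
the root. The root and the earlier pieces are untouched, so capturing persists. The generic family
is not known yet, hence the quantifier over `M`; below `δ < β` every such `M` coincides with `L`. -/
theorem exists_guidedBy_of_lt (hL : IsFamily τ L β) (hG : Guided 𝓟 S L β)
    {c : Σ l, Fin (τ.m l) → Ordinal.{0}} (hc : IsCond L β c) {δ : Ordinal.{0}} (hδ : δ < β)
    (b : Bool) {P : Set ℕ} (hP : P ∈ 𝓟) (A : Finset Ordinal.{0}) (hA : ∀ x ∈ A, ∃ j, c.2 j = x)
    (hδc : ∃ j, c.2 j = δ) {l : ℕ} {ψ : Fin (τ.m l) → Fin (τ.m c.1)} (hψ : Emb τ ψ)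
    (a : Fin (τ.m l)) (hψa : Translates ψ a) (ha : δ ≤ c.2 (ψ a)) (q : Finset (Fin (τ.m l))) :
    ∃ k, k + 1 ∈ P ∧ ∃ g, IsCond L β ⟨k + 1, g⟩ ∧ Extends c ⟨k + 1, g⟩ ∧
      ∀ M : ∀ k, Set (Fin (τ.m k) → Ordinal.{0}), (∀ k, L k ⊆ M k) →
        (∀ k, ∀ f ∈ M k, (∀ x, f x < β) → f ∈ L k) →
        GuidedBy M δ (S b δ) A (c.2 ∘ ψ) a q g := by
  obtain ⟨l', c⟩ := c
  change ∃ f ∈ L l', ∃ a, c = splice β f a at hc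
  obtain ⟨f₀, hf₀, a₀, rfl⟩ := hc
  dsimp only at *
  have hf₀lt := hL.lt f₀ hf₀
  have hδa : δ ≤ f₀ a₀ := by
    obtain ⟨j, hj⟩ := hδc
    have hja : j < a₀ := lt_of_splice_lt (by rw [hj]; exact hδ)
    rw [splice_of_lt hja] at hj
    rw [← hj]
    exact (hL.strictMono f₀ hf₀).monotone hja.le
  have hδc : δ ≤ f₀ (min a₀ (ψ a)) := by
    rcases le_or_gt a₀ (ψ a) with h | h
    · rwa [min_eq_left h]
    · rw [min_eq_right h.le]
      rwa [splice_of_lt h] at ha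
  -- The minimum makes `φ` a translation both from the cut `a₀` on and from `ψ a` on.
  obtain ⟨k, hk, f, hf, φ, hφ, hφT, i, h1, h2, h3, h4, h5⟩ := hG δ hδ b P hP
    (Finset.univ.image f₀) (by simpa using hf₀lt) l' f₀ hf₀ _ hδc (q.image ψ)
  have himg : (q.image ψ).image φ = q.image (φ ∘ ψ) := Finset.image_image
  rw [himg] at h4 h5
  have hf' := hL.closed f hf i
  have hmono := hL.strictMono _ hf'
  obtain ⟨χ₀, hχ₀, hχf₀⟩ := hL.exists_emb hf₀ hf' fun x => h2 (f₀ x) (by simp)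
  obtain ⟨χ, hχ, hT, hχeq⟩ := hχ₀.exists_translates a₀
  have hχf : ∀ x ≤ a₀, f (piece τ k i (χ x)) = f₀ x := fun x hx => by
    rw [hχeq x hx]; exact hχf₀ x
  have hφχ : ∀ x ≤ min a₀ (ψ a), φ x = χ x := fun x hx =>
    hmono.injective ((h1 x hx).trans (hχf x (hx.trans (min_le_left _ _))).symm)
  have hra : τ.r (k + 1) ≤ (χ a₀).1 := by
    rw [← not_lt, ← h3, hχf a₀ le_rfl, not_lt]
    exact hδa
  have hg : splice β f (piece τ k i (χ a₀)) ∘ piece τ k i = splice β (f ∘ piece τ k i) (χ a₀) :=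
    splice_comp (piece_strictMono _ _) (translates_piece _ hra)
  have hg' := congrFun hg
  simp only [Function.comp_apply] at hg'
  have hgχ : splice β (f ∘ piece τ k i) (χ a₀) ∘ χ = splice β f₀ a₀ := by
    rw [splice_comp hχ.strictMono hT]
    exact splice_congr fun x hx => hχf x hx.le
  have hroot : ∀ x : Fin (τ.m (k + 1)), x.1 < τ.r (k + 1) →
      splice β f (piece τ k i (χ a₀)) x = f x := fun x hx =>
    splice_of_lt (Fin.lt_def.2 (hx.trans_le (hra.trans (le_piece_val i _))))
  refine ⟨k, hk, splice β f (piece τ k i (χ a₀)), ⟨f, hf, _, rfl⟩,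
    ⟨piece τ k i ∘ χ, (Emb.piece i).comp hχ, ?_⟩,
    fun M hLM hML => ⟨φ ∘ ψ, hφ.comp hψ, (hφT.mono (min_le_right _ _)).comp hψa, i, ?_, ?_, ?_, ?_,
      ?_⟩⟩
  · exact (congrArg (· ∘ χ) hg).trans hgχ
  · intro x hx
    have hψx := hψ.strictMono.monotone hx
    simp only [Function.comp_apply]
    rw [hg']
    rcases le_or_gt a₀ (ψ a) with h | h
    · rw [min_eq_left h] at hφχ hφT h1
      rw [← hφχ a₀ le_rfl]
      refine (congrFun (splice_comp hφ.strictMono hφT) (ψ x)).trans ?_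
      exact congrFun (splice_congr fun y hy => h1 y hy.le) (ψ x)
    · rw [min_eq_right h.le] at hφχ h1
      rw [hφχ _ hψx]
      exact congrFun hgχ (ψ x)
  · intro x hx
    obtain ⟨j, rfl⟩ := hA x hx
    exact ⟨χ j, (hg' _).trans (congrFun hgχ j)⟩
  · intro j
    rw [hg']
    by_cases hj : j < χ a₀
    · rw [splice_of_lt hj]
      exact h3 j
    · have hj := not_lt.1 hj
      refine iff_of_false ((hδ.trans_le (le_splice hj)).not_gt) ?_
      rw [Fin.le_def] at hj
      omega
  · intro j hj
    rw [Finset.image_congr (g := f ∘ piece τ k j)]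
    · exact h4 j hj
    intro x _
    exact splice_of_lt (piece_lt_piece hj _ hra)
  · rcases h5 with ⟨g, hg, h6, h7⟩ | ⟨η, h6, h7, h8⟩
    · exact Or.inl ⟨g, hLM _ hg, h6, h7⟩
    · refine Or.inr ⟨η, h6, fun x hx => ?_, ?_⟩
      · by_cases hxa : x < piece τ k i (χ a₀)
        · rw [splice_of_lt hxa]
          exact h7 x hx
        · exact ((h7 x hx).trans (hL.lt f hf x).le).trans (le_splice (not_lt.1 hxa))
      · rintro ⟨g, hg, h9, h10, h11⟩
        exact h8 ⟨g, hML _ g hg fun x => (h9 x).trans hδ, h9,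
          fun x hx => (h10 x hx).trans (hroot x hx), h11⟩

end Stage

section Stage

variable {𝓟 : Set (Set ℕ)} {S : Bool → Ordinal.{0} → Set (Finset Ordinal.{0})}
  {L : ∀ k, Set (Fin (τ.m k) → Ordinal.{0})} {β : Ordinal.{0}}

/-- Among the functions `g` which agree with `f` on the root, one can choose one and a number `i` of
captured pieces so that no more than `i` pieces are captured cofinally often. -/
theorem exists_maximal_capture {k : ℕ} {f : Fin (τ.m (k + 1)) → Ordinal.{0}} (hf : f ∈ L (k + 1))
    (hβ : 0 < β) (T : Set (Finset Ordinal.{0})) (p : Finset (Fin (τ.m k))) :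
    ∃ g ∈ L (k + 1), ∃ i : Fin (τ.n (k + 1)),
      (∀ x : Fin (τ.m (k + 1)), x.1 < τ.r (k + 1) → g x = f x) ∧
      (∀ j < i, p.image (g ∘ piece τ k j) ∈ T) ∧
      ((∃ g ∈ L (k + 1), (∀ x, g x < β) ∧ ∀ j, p.image (g ∘ piece τ k j) ∈ T) ∨
        ∃ η < β, (i ≠ τ.fst k → ∀ x : Fin (τ.m (k + 1)), τ.r (k + 1) ≤ x.1 → η ≤ g x) ∧
          ¬ ∃ g ∈ L (k + 1), (∀ x, g x < β) ∧
            (∀ x : Fin (τ.m (k + 1)), x.1 < τ.r (k + 1) → g x = f x) ∧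
            (∀ x : Fin (τ.m (k + 1)), τ.r (k + 1) ≤ x.1 → η ≤ g x) ∧
            ∀ j ≤ i, p.image (g ∘ piece τ k j) ∈ T) := by
  classical
  -- `W t` says that, for the root of `f`, the first `t` pieces can be captured by functions lying
  -- arbitrarily high below `β` beyond the root. The index `i` is the least `t` at which `W (t + 1)`
  -- fails, and `η` witnesses the failure.
  let W : ℕ → Prop := fun t => ∀ η < β, ∃ g ∈ L (k + 1), (∀ x, g x < β) ∧
    (∀ x : Fin (τ.m (k + 1)), x.1 < τ.r (k + 1) → g x = f x) ∧
    (∀ x : Fin (τ.m (k + 1)), τ.r (k + 1) ≤ x.1 → η ≤ g x) ∧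
    ∀ j : Fin (τ.n (k + 1)), j.1 < t → p.image (g ∘ piece τ k j) ∈ T
  have hn := τ.two_le_n (k + 1) (by omega)
  have hfst : ∀ j, ¬ j < τ.fst k := fun j hj => Nat.not_lt_zero _ (Fin.lt_def.1 hj)
  by_cases hW : W (τ.n (k + 1))
  · obtain ⟨g, hg, h1, -, -, h2⟩ := hW 0 hβ
    exact ⟨f, hf, τ.fst k, fun _ _ => rfl, fun j hj => absurd hj (hfst j),
      Or.inl ⟨g, hg, h1, fun j => h2 j j.2⟩⟩
  · have hex : ∃ t, ¬ W (t + 1) := ⟨τ.n (k + 1) - 1, by rwa [Nat.sub_add_cancel (by omega)]⟩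
    have hlt : Nat.find hex < τ.n (k + 1) :=
      lt_of_le_of_lt (Nat.find_min' hex (by rwa [Nat.sub_add_cancel (by omega)]))
        (Nat.sub_lt (by omega) Nat.one_pos)
    obtain ⟨η, hη, hno⟩ : ∃ η < β, ¬ ∃ g ∈ L (k + 1), (∀ x, g x < β) ∧
        (∀ x : Fin (τ.m (k + 1)), x.1 < τ.r (k + 1) → g x = f x) ∧
        (∀ x : Fin (τ.m (k + 1)), τ.r (k + 1) ≤ x.1 → η ≤ g x) ∧
        ∀ j : Fin (τ.n (k + 1)), j.1 < Nat.find hex + 1 → p.image (g ∘ piece τ k j) ∈ T := by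
      by_contra H
      exact Nat.find_spec hex fun η hη => by_contra fun h => H ⟨η, hη, h⟩
    have hno' : ¬ ∃ g ∈ L (k + 1), (∀ x, g x < β) ∧
        (∀ x : Fin (τ.m (k + 1)), x.1 < τ.r (k + 1) → g x = f x) ∧
        (∀ x : Fin (τ.m (k + 1)), τ.r (k + 1) ≤ x.1 → η ≤ g x) ∧
        ∀ j ≤ (⟨Nat.find hex, hlt⟩ : Fin (τ.n (k + 1))), p.image (g ∘ piece τ k j) ∈ T := by
      rintro ⟨g, h1, h2, h3, h4, h5⟩
      exact hno ⟨g, h1, h2, h3, h4, fun j hj => h5 j (Fin.le_def.2 (Nat.lt_succ_iff.1 hj))⟩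
    -- For `i = 0` nothing has to be captured beforehand, so `f` itself serves, without a lower
    -- bound beyond the root.
    by_cases h0 : Nat.find hex = 0
    · refine ⟨f, hf, ⟨Nat.find hex, hlt⟩, fun _ _ => rfl, fun j hj => ?_, Or.inr ⟨η, hη, ?_, hno'⟩⟩
      · rw [Fin.lt_def] at hj
        simp only [h0] at hj
        omega
      · exact fun h => absurd (Fin.ext h0) h
    · obtain ⟨t, ht⟩ := Nat.exists_eq_succ_of_ne_zero h0
      have hWt : W (t + 1) := by
        by_contra h
        have := Nat.find_min' hex h
        omega
      obtain ⟨g, hg, h1, h2, h3, h4⟩ := hWt η hη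
      exact ⟨g, hg, ⟨Nat.find hex, hlt⟩, h2,
        fun j hj => h4 j (lt_of_lt_of_eq (Fin.lt_def.1 hj) ht),
        Or.inr ⟨η, hη, fun _ => h3, hno'⟩⟩

/-- For the empty guess the first piece works, since nothing can be captured. For `δ = β` the
function with maximal `i` is cut in its `i`-th piece right after the root: earlier pieces remain
captured, the rest moves to `β` and above, and maximality becomes the second alternative of
`Captured`. -/
theorem exists_captured {k : ℕ} {f : Fin (τ.m (k + 1)) → Ordinal.{0}}
    (hf : f ∈ L (k + 1)) {δ : Ordinal.{0}} (hδ : β ≤ δ) {T : Set (Finset Ordinal.{0})}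
    {a : Fin (τ.m k)} (hβ : 0 < β)
    (hT : T = ∅ ∨ δ = β ∧ a.1 = τ.r (k + 1)) (p : Finset (Fin (τ.m k))) :
    ∃ g, IsCond L β ⟨k + 1, g⟩ ∧ ∃ i,
      g ∘ piece τ k i = splice β (f ∘ piece τ k (τ.fst k)) a ∧
      ∀ M : ∀ k, Set (Fin (τ.m k) → Ordinal.{0}),
        (∀ k, L k ⊆ M k) → (∀ k, ∀ f ∈ M k, (∀ x, f x < β) → f ∈ L k) →
        Captured M δ T g i p := by
  have hfst : ∀ j, ¬ j < τ.fst k := fun j hj => Nat.not_lt_zero _ (Fin.lt_def.1 hj)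
  rcases hT with rfl | ⟨rfl, ha⟩
  · refine ⟨splice β f (piece τ k (τ.fst k) a), ⟨f, hf, _, rfl⟩, τ.fst k,
      splice_comp (piece_strictMono _ _) (translates_piece_fst a), fun M _ _ =>
      ⟨fun j hj => absurd hj (hfst j),
        Or.inr ⟨0, fun h => pos_of_ne_zero h, fun _ _ => zero_le, ?_⟩⟩⟩
    rintro ⟨g, -, -, -, -, h⟩
    exact h _ le_rfl
  · obtain ⟨g, hg, i, h1, h2, h3⟩ := exists_maximal_capture hf hβ T p
    have hgroot : ∀ x : Fin (τ.m (k + 1)), x.1 < τ.r (k + 1) →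
        splice δ g (piece τ k i a) x = f x := fun x hx => by
      rw [splice_of_lt, h1 x hx]
      rw [Fin.lt_def]
      have := le_piece_val i a
      omega
    refine ⟨splice δ g (piece τ k i a), ⟨g, hg, _, rfl⟩, i, ?_, fun M hLM hML => ⟨?_, ?_⟩⟩
    · rw [splice_comp (piece_strictMono _ _) (translates_piece i ha.ge)]
      refine splice_congr fun x hx => ?_
      rw [Fin.lt_def] at hx
      simp only [Function.comp_apply]
      rw [h1 _ ((piece_val_lt_r_iff i x).2 (by omega))]
      refine congrArg f (Fin.ext ?_)
      rw [piece_val_of_lt _ (by omega), piece_fst_val]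
    · intro j hj
      rw [Finset.image_congr (g := g ∘ piece τ k j)]
      · exact h2 j hj
      intro x _
      exact splice_of_lt (piece_lt_piece hj _ ha.ge)
    · rcases h3 with ⟨g', hg', h4, h5⟩ | ⟨η, hη, h4, h5⟩
      · exact Or.inl ⟨g', hLM _ hg', h4, h5⟩
      · refine Or.inr ⟨η, fun _ => hη, fun x hx => ?_, ?_⟩
        · by_cases hxa : x < piece τ k i a
          · rw [splice_of_lt hxa]
            refine h4 ?_ x hx
            -- In the first piece the cut is at the end of the root, so no position beyond the root
            -- precedes it.
            rintro rfl
            rw [Fin.lt_def, piece_fst_val] at hxa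
            omega
          · exact hη.le.trans (le_splice (not_lt.1 hxa))
        · rintro ⟨g', hg', h6, h7, h8⟩
          exact h5 ⟨g', hML _ g' hg' h6, h6, fun x hx => (h7 x hx).trans (hgroot x hx), h8⟩

/-- The root is arranged to end `n` positions after the cut, that is, at the value `β + n`. Only `n
= 0` gives a limit, so only there can the guess be nonempty. -/
theorem exists_guidedBy_of_le (hL : IsFamily τ L β) (hG : Guided 𝓟 S L β)
    (hS : ∀ δ, S false δ = ∅) (hS' : ∀ b δ, ¬ Order.IsSuccLimit δ → S b δ = ∅)
    (hβ : Order.IsSuccLimit β)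
    {c : Σ l, Fin (τ.m l) → Ordinal.{0}} (hc : IsCond L β c) {n : ℕ} {δ : Ordinal.{0}}
    (hδ : δ = β + (n : Ordinal.{0}))
    (b : Bool) {P : Set ℕ} (hP : P ∈ 𝓟) (A : Finset Ordinal.{0}) (hA : ∀ x ∈ A, ∃ j, c.2 j = x)
    {l : ℕ} {ψ : Fin (τ.m l) → Fin (τ.m c.1)} (hψ : Emb τ ψ)
    (a : Fin (τ.m l)) (hψa : Translates ψ a) (ha : δ ≤ c.2 (ψ a)) (q : Finset (Fin (τ.m l))) :
    ∃ k, k + 1 ∈ P ∧ ∃ g, IsCond L β ⟨k + 1, g⟩ ∧ Extends c ⟨k + 1, g⟩ ∧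
      ∀ M : ∀ k, Set (Fin (τ.m k) → Ordinal.{0}), (∀ k, L k ⊆ M k) →
        (∀ k, ∀ f ∈ M k, (∀ x, f x < β) → f ∈ L k) →
        GuidedBy M δ (S b δ) A (c.2 ∘ ψ) a q g := by
  obtain ⟨l', c⟩ := c
  change ∃ f ∈ L l', ∃ a, c = splice β f a at hc
  obtain ⟨f₀, hf₀, a₀, rfl⟩ := hc
  dsimp only at *
  have hβδ : β ≤ δ := by rw [hδ]; exact le_self_add
  have ha₀ : a₀ ≤ ψ a := by
    by_contra h
    rw [splice_of_lt (not_le.1 h)] at ha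
    exact ((hL.lt f₀ hf₀ _).trans_le hβδ).not_ge ha
  obtain ⟨k, hk, f, hf, -, χ, hχ, hT, hsp, hr, -⟩ := hG.exists_root_emb hL hS hβ hP ∅ (by simp)
    hf₀ a₀ n n le_rfl
  have hlim : S b δ = ∅ ∨ δ = β ∧ (χ a₀).1 = τ.r (k + 1) := by
    rcases Nat.eq_zero_or_pos n with rfl | hn
    · exact Or.inr ⟨by simpa using hδ, by simpa using hr⟩
    · refine Or.inl (hS' b δ fun h => ?_)
      obtain ⟨n, rfl⟩ := Nat.exists_eq_succ_of_ne_zero hn.ne'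
      rw [hδ, Nat.succ_eq_add_one, Nat.cast_succ, ← add_assoc] at h
      exact h.isSuccPrelimit.succ_ne _ rfl
  obtain ⟨g, hg, i, hgi, hcap⟩ := exists_captured hf hβδ hβ.bot_lt hlim
    (q.image (χ ∘ ψ))
  have hgi' := congrFun hgi
  simp only [Function.comp_apply] at hgi'
  refine ⟨k, hk, g, hg, ⟨piece τ k i ∘ χ, (Emb.piece i).comp hχ, ?_⟩, fun M hLM hML =>
    ⟨χ ∘ ψ, hχ.comp hψ, (hT.mono ha₀).comp hψa, i, ?_, ?_, ?_, hcap M hLM hML⟩⟩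
  · exact (congrArg (· ∘ χ) hgi).trans hsp
  · intro x _
    exact (hgi' _).trans (congrFun hsp _)
  · intro x hx
    obtain ⟨j, rfl⟩ := hA x hx
    exact ⟨χ j, (hgi' _).trans (congrFun hsp j)⟩
  · intro j
    rw [hgi']
    by_cases hj : j < χ a₀
    · rw [splice_of_lt hj]
      refine iff_of_true ((hL.lt f hf _).trans_le hβδ) ?_
      rw [Fin.lt_def] at hj
      omega
    · have hj := not_lt.1 hj
      rw [splice_of_le hj, hδ, add_lt_add_iff_left, Nat.cast_lt]
      rw [Fin.le_def] at hj
      omega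

/-- The condition is first enlarged to contain `A` and `δ`, and the embedding of the configuration
is replaced by one that translates from `a` on; the two cases for `δ` then apply. -/
theorem exists_guidedBy (hL : IsFamily τ L β) (hG : Guided 𝓟 S L β)
    (hS : ∀ δ, S false δ = ∅) (hS' : ∀ b δ, ¬ Order.IsSuccLimit δ → S b δ = ∅)
    (hβ : Order.IsSuccLimit β)
    {c : Σ l, Fin (τ.m l) → Ordinal.{0}} (hc : IsCond L β c) {δ : Ordinal.{0}}
    (hδ : δ < β + ω)
    (b : Bool) {P : Set ℕ} (hP : P ∈ 𝓟) (A : Finset Ordinal.{0}) (hA : ∀ x ∈ A, x < β + ω)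
    {l : ℕ} {ψ : Fin (τ.m l) → Fin (τ.m c.1)} (hψ : Emb τ ψ)
    (a : Fin (τ.m l)) (ha : δ ≤ c.2 (ψ a)) (q : Finset (Fin (τ.m l))) :
    ∃ k, k + 1 ∈ P ∧ ∃ g, IsCond L β ⟨k + 1, g⟩ ∧ Extends c ⟨k + 1, g⟩ ∧
      ∀ M : ∀ k, Set (Fin (τ.m k) → Ordinal.{0}), (∀ k, L k ⊆ M k) →
        (∀ k, ∀ f ∈ M k, (∀ x, f x < β) → f ∈ L k) →
        GuidedBy M δ (S b δ) A (c.2 ∘ ψ) a q g := by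
  obtain ⟨c', hc', hcc', hA'⟩ := exists_extends_cover hL hG hS hβ ⟨P, hP⟩ hc (insert δ A)
    (by simpa [hδ] using hA)
  obtain ⟨χ, hχ, hχc⟩ := hcc'
  obtain ⟨ψ', hψ', hψ'T, hψ'eq⟩ := (hχ.comp hψ).exists_translates a
  have heq : ∀ x ≤ a, c'.2 (ψ' x) = c.2 (ψ x) := fun x hx => by
    rw [hψ'eq x hx, ← hχc]
    rfl
  have key : ∃ k, k + 1 ∈ P ∧ ∃ g, IsCond L β ⟨k + 1, g⟩ ∧ Extends c' ⟨k + 1, g⟩ ∧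
      ∀ M : ∀ k, Set (Fin (τ.m k) → Ordinal.{0}), (∀ k, L k ⊆ M k) →
        (∀ k, ∀ f ∈ M k, (∀ x, f x < β) → f ∈ L k) →
        GuidedBy M δ (S b δ) A (c'.2 ∘ ψ') a q g := by
    have hA'' : ∀ x ∈ A, ∃ j, c'.2 j = x := fun x hx => hA' x (by simp [hx])
    have ha' : δ ≤ c'.2 (ψ' a) := by rwa [heq a le_rfl]
    by_cases hδβ : δ < β
    · exact exists_guidedBy_of_lt hL hG hc' hδβ b hP A hA'' (hA' δ (by simp)) hψ' a hψ'T ha' q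
    · obtain ⟨N, hN⟩ := exists_nat_bound {δ} (by simpa using hδ)
      obtain ⟨n, -, hn⟩ := hN δ (by simp) (not_lt.1 hδβ)
      exact exists_guidedBy_of_le hL hG hS hS' hβ hc' hn b hP A hA'' hψ' a hψ'T ha' q
  obtain ⟨k, hk, g, hg, hext, H⟩ := key
  refine ⟨k, hk, g, hg, Extends.trans ⟨χ, hχ, hχc⟩ hext, fun M hLM hML => ?_⟩
  obtain ⟨φ, hφ, hφT, i, h1, h2⟩ := H M hLM hML
  exact ⟨φ, hφ, hφT, i, fun x hx => (h1 x hx).trans (heq x hx), h2⟩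

end Stage

/-! ### The generic extension from `β` to `β + ω` -/

theorem exists_generic_sequence {X ι : Type*} [Countable ι] [Nonempty ι] {R : X → X → Prop}
    (hrefl : ∀ x, R x x) (htrans : ∀ x y z, R x y → R y z → R x z) {C : Set X} (hC : C.Nonempty)
    (Q : ι → Set X) (hQ : ∀ c ∈ C, ∀ t, ∃ c' ∈ C, R c c' ∧ c' ∈ Q t) :
    ∃ u : ℕ → X, (∀ n, u n ∈ C) ∧ (∀ m n, m ≤ n → R (u m) (u n)) ∧ ∀ t, ∃ n, u n ∈ Q t := by
  obtain ⟨e, he⟩ := exists_surjective_nat ι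
  choose F hF1 hF2 hF3 using hQ
  obtain ⟨c₀, hc₀⟩ := hC
  let v : ℕ → C := fun n => Nat.rec ⟨c₀, hc₀⟩ (fun n c => ⟨F c.1 c.2 (e n), hF1 _ _ _⟩) n
  refine ⟨fun n => (v n).1, fun n => (v n).2, fun m n hmn => ?_, fun t => ?_⟩
  · induction hmn with
    | refl => exact hrefl _
    | step _ ih => exact htrans _ _ _ ih (hF2 _ _ _)
  · obtain ⟨n, rfl⟩ := he t
    exact ⟨n + 1, hF3 _ _ _⟩

theorem countable_of_isPartition {𝓟 : Set (Set ℕ)} (h : Setoid.IsPartition 𝓟) : 𝓟.Countable := by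
  choose f hf using fun a => (h.2 a).exists
  refine (Set.countable_range f).mono fun P hP => ?_
  obtain ⟨a, ha⟩ := Setoid.nonempty_of_mem_partition h hP
  exact ⟨a, (h.2 a).unique (hf a) ⟨hP, ha⟩⟩

theorem countable_Iio_of_lt_omega_one {β : Ordinal.{0}} (hβ : β < ω₁) :
    Countable (Set.Iio β) := by
  rw [← Cardinal.mk_le_aleph0_iff, Cardinal.mk_Iio_ordinal, Cardinal.lift_le_aleph0,
    ← Cardinal.lt_aleph_one_iff, ← Cardinal.lt_ord]
  simpa using hβ

theorem exists_family_extension {𝓟 : Set (Set ℕ)}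
    {S : Bool → Ordinal.{0} → Set (Finset Ordinal.{0})}
    {L : ∀ k, Set (Fin (τ.m k) → Ordinal.{0})} {β : Ordinal.{0}} (h𝓟 : Setoid.IsPartition 𝓟)
    (hS : ∀ δ, S false δ = ∅) (hS' : ∀ b δ, ¬ Order.IsSuccLimit δ → S b δ = ∅)
    (hβ : Order.IsSuccLimit β) (hβω : β + ω < ω₁) (hL : IsFamily τ L β) (hG : Guided 𝓟 S L β) :
    ∃ M : ∀ k, Set (Fin (τ.m k) → Ordinal.{0}), IsFamily τ M (β + ω) ∧ Guided 𝓟 S M (β + ω) ∧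
      (∀ k, L k ⊆ M k) ∧ ∀ k, ∀ f ∈ M k, (∀ x, f x < β) → f ∈ L k := by
  have h𝓟ne : 𝓟.Nonempty := ⟨_, (h𝓟.2 0).exists.choose_spec.1⟩
  have := countable_Iio_of_lt_omega_one hβω
  have := (countable_of_isPartition h𝓟).to_subtype
  have : Nonempty 𝓟 := h𝓟ne.to_subtype
  have : Nonempty (Set.Iio (β + ω)) := ⟨⟨0, hβ.bot_lt.trans_le le_self_add⟩⟩
  have : Nonempty (Fin (τ.m 0)) := ⟨⟨0, τ.m_pos 0⟩⟩
  let B := Set.Iio (β + ω)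
  let ι := B × Bool × 𝓟 × Finset B ×
    (Σ l, (Fin (τ.m l) → B) × Fin (τ.m l) × Finset (Fin (τ.m l)))
  have : Nonempty (Σ l, (Fin (τ.m l) → B) × Fin (τ.m l) × Finset (Fin (τ.m l))) :=
    ⟨⟨0, Classical.arbitrary _⟩⟩
  -- Since the new family is not known in advance, `h` ranges over all functions. A condition meets
  -- the requirement either by excluding `h` from all its extensions or by guiding `h` itself; this
  -- disjunction makes `Q` dense, and the first alternative fails for every `h` in the generic
  -- family.
  let Q : ι → Set (Σ l, Fin (τ.m l) → Ordinal.{0}) := fun ⟨δ, b, P, A, l, h, a, q⟩ =>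
    {c | (∀ x ∈ A, ∃ j, c.2 j = x.1) ∧ (δ.1 ≤ (h a).1 →
      (∀ c', IsCond L β c' → Extends c c' → ¬ ∃ ψ : Fin (τ.m l) → Fin (τ.m c'.1), Emb τ ψ ∧
        c'.2 ∘ ψ = fun x => (h x).1) ∨
      ∃ k, k + 1 ∈ P.1 ∧ ∃ g, c = ⟨k + 1, g⟩ ∧
        ∀ M : ∀ k, Set (Fin (τ.m k) → Ordinal.{0}), (∀ k, L k ⊆ M k) →
          (∀ k, ∀ f ∈ M k, (∀ x, f x < β) → f ∈ L k) →
          GuidedBy M δ.1 (S b δ.1) (A.image Subtype.val) (fun x => (h x).1) a q g)}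
  have hne : {c | IsCond L β c}.Nonempty := by
    obtain ⟨k, f, hf, -⟩ := hL.cover ∅ (by simp)
    exact ⟨⟨k, splice β f ⟨0, τ.m_pos k⟩⟩, f, hf, ⟨0, τ.m_pos k⟩, rfl⟩
  have hext : ∀ {c c' : Σ l, Fin (τ.m l) → Ordinal.{0}}, Extends c c' → ∀ x, (∃ j, c.2 j = x) →
      ∃ j, c'.2 j = x := by
    rintro c c' ⟨ψ, -, h⟩ x ⟨j, rfl⟩
    exact ⟨ψ j, congrFun h j⟩
  obtain ⟨u, huC, humono, huQ⟩ := exists_generic_sequence (R := Extends (τ := τ))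
      Extends.refl (fun _ _ _ => Extends.trans) hne Q (by
    rintro c hc ⟨δ, b, P, A, l, h, a, q⟩
    obtain ⟨c₁, hc₁, hcc₁, hA⟩ := exists_extends_cover hL hG hS hβ h𝓟ne hc
      (A.image Subtype.val) (by
        intro x hx
        obtain ⟨y, -, rfl⟩ := Finset.mem_image.1 hx
        exact y.2)
    replace hA : ∀ x ∈ A, ∃ j, c₁.2 j = x.1 := fun x hx => hA _ (Finset.mem_image_of_mem _ hx)
    by_cases H : δ.1 ≤ (h a).1 ∧ ∃ c', IsCond L β c' ∧ Extends c₁ c' ∧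
        ∃ ψ : Fin (τ.m l) → Fin (τ.m c'.1), Emb τ ψ ∧ c'.2 ∘ ψ = fun x => (h x).1
    · obtain ⟨hδ, c₂, hc₂, h₁₂, ψ, hψ, hψc⟩ := H
      obtain ⟨k, hk, g, hg, h₂g, Hg⟩ := exists_guidedBy hL hG hS hS' hβ hc₂ δ.2 b P.2
        (A.image Subtype.val) (by
          intro x hx
          obtain ⟨y, -, rfl⟩ := Finset.mem_image.1 hx
          exact y.2) hψ a (hδ.trans_eq (congrFun hψc a).symm) q
      rw [hψc] at Hg
      exact ⟨_, hg, hcc₁.trans (h₁₂.trans h₂g),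
        fun x hx => hext (h₁₂.trans h₂g) _ (hA x hx), fun _ => Or.inr ⟨k, hk, g, rfl, Hg⟩⟩
    · refine ⟨c₁, hc₁, hcc₁, hA, fun hδ => Or.inl fun c' hc' h₁ h₂ => H ⟨hδ, c', hc', h₁, h₂⟩⟩)
  have hlift : ∀ A : Finset Ordinal.{0}, (∀ x ∈ A, x < β + ω) →
      ∃ A' : Finset B, A'.image Subtype.val = A := fun A hA => by
    refine ⟨A.attach.image fun x => ⟨x.1, hA x.1 x.2⟩, ?_⟩
    rw [Finset.image_image]
    exact A.attach_image_val
  have hcover : ∀ A : Finset Ordinal.{0}, (∀ x ∈ A, x < β + ω) →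
      ∃ c ∈ Set.range u, ∀ x ∈ A, ∃ j, c.2 j = x := by
    intro A hA
    obtain ⟨A', rfl⟩ := hlift A hA
    obtain ⟨n, hn⟩ := huQ ⟨Classical.arbitrary _, true, Classical.arbitrary _, A', 0,
      fun _ => Classical.arbitrary _, Classical.arbitrary _, ∅⟩
    refine ⟨u n, ⟨n, rfl⟩, fun x hx => ?_⟩
    obtain ⟨y, hy, rfl⟩ := Finset.mem_image.1 hx
    exact hn.1 y hy
  have hLM : ∀ k, L k ⊆ restrictions τ (Set.range u) k := by
    intro k f hf
    obtain ⟨_, ⟨n, rfl⟩, hn⟩ := hcover (Finset.univ.image f) (by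
      intro x hx
      obtain ⟨j, -, rfl⟩ := Finset.mem_image.1 hx
      exact (hL.lt f hf j).trans_le le_self_add)
    obtain ⟨f₀, hf₀, a₀, hu⟩ := huC n
    have hj : ∀ x, ∃ j < a₀, f₀ j = f x := by
      intro x
      obtain ⟨j, hj⟩ := hn (f x) (by simp)
      rw [hu] at hj
      have hja := lt_of_splice_lt (hj.trans_lt (hL.lt f hf x))
      exact ⟨j, hja, by rwa [splice_of_lt hja] at hj⟩
    obtain ⟨φ, hφ, hφf⟩ := hL.exists_emb hf hf₀ fun x => ⟨_, (hj x).choose_spec.2⟩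
    refine ⟨u n, ⟨n, rfl⟩, φ, hφ, funext fun x => ?_⟩
    obtain ⟨j, hja, hjx⟩ := hj x
    have : φ x = j := (hL.strictMono _ hf₀).injective ((hφf x).trans hjx.symm)
    rw [hu, Function.comp_apply, this, splice_of_lt hja, hjx]
  have hML : ∀ k, ∀ f ∈ restrictions τ (Set.range u) k, (∀ x, f x < β) → f ∈ L k := by
    rintro k _ ⟨_, ⟨n, rfl⟩, φ, hφ, rfl⟩ hlt
    obtain ⟨f₀, hf₀, a₀, hu⟩ := huC n
    convert hL.comp_mem hφ hf₀ using 1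
    funext x
    have := hlt x
    rw [hu] at this ⊢
    exact splice_of_lt (lt_of_splice_lt this)
  have hM : IsFamily τ (restrictions τ (Set.range u)) (β + ω) := by
    refine isFamily_restrictions ?_ ?_ ?_ hcover
    · rintro _ ⟨n, rfl⟩
      obtain ⟨f₀, hf₀, a₀, hu⟩ := huC n
      rw [hu]
      exact strictMono_splice (hL.strictMono _ hf₀) (hL.lt _ hf₀)
    · rintro _ ⟨n, rfl⟩ x
      obtain ⟨f₀, hf₀, a₀, hu⟩ := huC n
      rw [hu]
      exact splice_lt (hL.lt _ hf₀)
    · rintro _ ⟨n, rfl⟩ _ ⟨n', rfl⟩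
      exact ⟨u (max n n'), ⟨_, rfl⟩, humono _ _ (le_max_left _ _), humono _ _ (le_max_right _ _)⟩
  refine ⟨restrictions τ (Set.range u), hM, ?_, hLM, hML⟩
  intro δ hδ b P hP A hA l h hh a hδa q
  obtain ⟨A', rfl⟩ := hlift A hA
  obtain ⟨n, hn⟩ := huQ ⟨⟨δ, hδ⟩, b, ⟨P, hP⟩, A', l, fun x => ⟨h x, hM.lt h hh x⟩, a, q⟩
  rcases hn.2 hδa with H | ⟨k, hk, g, hg, H⟩
  · obtain ⟨_, ⟨n', rfl⟩, φ, hφ, rfl⟩ := hh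
    obtain ⟨ψ, hψ, hψu⟩ := humono n' (max n n') (le_max_right _ _)
    refine absurd ⟨ψ ∘ φ, hψ.comp hφ, ?_⟩ (H (u (max n n')) (huC _) (humono _ _ (le_max_left _ _)))
    simp only [← hψu]
    rfl
  · have := H _ hLM hML
    exact ⟨k, hk, g, ⟨u n, ⟨n, rfl⟩, by rw [hg]; exact ⟨id, Emb.refl _, rfl⟩⟩, this⟩

/-! ### The scheme over `ω` -/

theorem Emb.exists_val_eq {l k : ℕ} (h : l ≤ k) :
    ∃ φ : Fin (τ.m l) → Fin (τ.m k), Emb τ φ ∧ ∀ x, (φ x).1 = x.1 := by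
  induction h with
  | refl => exact ⟨id, Emb.refl _, fun _ => rfl⟩
  | step _ ih =>
    obtain ⟨φ, hφ, h⟩ := ih
    exact ⟨_, (Emb.piece (τ.fst _)).comp hφ, fun x => (piece_fst_val _).trans (h x)⟩

theorem natCast_le_of_strictMono {m : ℕ} {g : Fin m → Ordinal.{0}} (hg : StrictMono g) (x : Fin m) :
    (x.1 : Ordinal.{0}) ≤ g x := by
  obtain ⟨t, ht⟩ := x
  induction t with
  | zero => simp
  | succ t ih =>
    have h1 := ih (by omega)
    have h2 : g ⟨t, by omega⟩ < g ⟨t + 1, ht⟩ := hg (by simp [Fin.lt_def])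
    simp only [Nat.cast_succ] at h1 ⊢
    exact Order.add_one_le_of_lt (h1.trans_lt h2)

/-- The scheme over `ω` in which every `τ.m k` is an element of level `k`. -/
def baseFamily (τ : SchemeType) : ∀ k, Set (Fin (τ.m k) → Ordinal.{0}) :=
  restrictions τ (Set.range fun l => ⟨l, fun j => (j.1 : Ordinal.{0})⟩)

theorem isFamily_baseFamily : IsFamily τ (baseFamily τ) ω := by
  have hext : ∀ l k, l ≤ k → Extends (τ := τ) ⟨l, fun j => (j.1 : Ordinal.{0})⟩
      ⟨k, fun j => (j.1 : Ordinal.{0})⟩ := by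
    intro l k h
    obtain ⟨φ, hφ, hφ'⟩ := Emb.exists_val_eq (τ := τ) h
    exact ⟨φ, hφ, funext fun x => congrArg Nat.cast (hφ' x)⟩
  refine isFamily_restrictions ?_ ?_ ?_ ?_
  · rintro _ ⟨l, rfl⟩ x y hxy
    exact Nat.cast_lt.2 (Fin.lt_def.1 hxy)
  · rintro _ ⟨l, rfl⟩ x
    exact Ordinal.natCast_lt_omega0 _
  · rintro _ ⟨l, rfl⟩ _ ⟨k, rfl⟩
    exact ⟨_, ⟨max l k, rfl⟩, hext _ _ (le_max_left _ _), hext _ _ (le_max_right _ _)⟩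
  · intro A hA
    obtain ⟨N, hN⟩ := exists_nat_bound (β := 0) A (by simpa using hA)
    refine ⟨_, ⟨N + 1, rfl⟩, fun x hx => ?_⟩
    obtain ⟨n, hn, rfl⟩ := hN x hx zero_le
    have := τ.m_strictMono.le_apply (x := N + 1)
    exact ⟨⟨n, by simp only; omega⟩, by simp⟩

/-- For `δ = n`, compatibility yields arbitrarily large levels in `P` with root size `n`, and an
initial segment of `ω` serves as `f`. The maximality clause holds because no strictly increasing
function with more than `n` arguments has all its values below `n`. -/
theorem guided_baseFamily {𝓟 : Set (Set ℕ)} (h𝓟 : CompatiblePartition τ 𝓟)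
    (S : Bool → Ordinal.{0} → Set (Finset Ordinal.{0})) :
    Guided 𝓟 S (baseFamily τ) ω := by
  rintro δ hδ b P hP A hA l _ ⟨_, ⟨l', rfl⟩, φ₀, hφ₀, rfl⟩ a - q
  obtain ⟨n, rfl⟩ := Ordinal.lt_omega0.1 hδ
  obtain ⟨N, hN⟩ := exists_nat_bound (β := 0) A (by simpa using hA)
  obtain ⟨t, ⟨htP, ht, hr⟩, hlt⟩ := (h𝓟.2 P hP n).exists_gt (l' + N + 1)
  obtain ⟨k, rfl⟩ := Nat.exists_eq_succ_of_ne_zero (by omega : t ≠ 0)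
  obtain ⟨ψ, hψ, hψT, hψeq⟩ := hφ₀.exists_translates a
  obtain ⟨ι, hι, hιv⟩ := Emb.exists_val_eq (τ := τ) (l := l') (k := k) (by omega)
  have hm := τ.m_strictMono.le_apply (x := k)
  have hrm := τ.r_lt_m k
  have hmm := τ.m_lt_m_succ k
  simp only [Nat.succ_eq_add_one] at *
  refine ⟨k, htP, fun j => (j.1 : Ordinal.{0}), ⟨_, ⟨k + 1, rfl⟩, id, Emb.refl _, rfl⟩, ι ∘ ψ,
    hι.comp hψ, fun j hj => ?_, τ.fst k, fun x hx => ?_, fun x hx => ?_, fun j => ?_,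
    fun j hj => ?_, Or.inr ⟨0, fun h => pos_of_ne_zero h, fun _ _ => zero_le, ?_⟩⟩
  · simp only [Function.comp_apply, hιv]
    exact hψT j hj
  · simp only [Function.comp_apply, piece_fst_val, hιv, hψeq x hx]
  · obtain ⟨y, hy, rfl⟩ := hN x hx zero_le
    exact ⟨⟨y, by omega⟩, by simp [piece_fst_val]⟩
  · dsimp only
    rw [piece_fst_val, hr, Nat.cast_lt]
  · exact absurd (Fin.lt_def.1 hj) (Nat.not_lt_zero _)
  · rintro ⟨g, hg, h1, -⟩
    have h2 := natCast_le_of_strictMono (isFamily_baseFamily.strictMono g hg) ⟨n, by omega⟩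
    exact (h1 _).not_ge h2

/-! ### The recursion -/

theorem GuidedBy.mono {L M : ∀ k, Set (Fin (τ.m k) → Ordinal.{0})} {δ : Ordinal.{0}}
    {S : Set (Finset Ordinal.{0})} {A : Finset Ordinal.{0}} {l : ℕ}
    {h : Fin (τ.m l) → Ordinal.{0}} {a : Fin (τ.m l)} {q : Finset (Fin (τ.m l))} {k : ℕ}
    {f : Fin (τ.m (k + 1)) → Ordinal.{0}} (H : GuidedBy L δ S A h a q f) (hLM : ∀ k, L k ⊆ M k)
    (hML : ∀ k, ∀ f ∈ M k, (∀ x, f x < δ) → f ∈ L k) : GuidedBy M δ S A h a q f := by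
  obtain ⟨φ, hφ, hT, i, h1, h2, h3, h4, h5⟩ := H
  refine ⟨φ, hφ, hT, i, h1, h2, h3, h4, ?_⟩
  rcases h5 with ⟨g, hg, h6⟩ | ⟨η, h6, h7, h8⟩
  · exact Or.inl ⟨g, hLM _ hg, h6⟩
  · refine Or.inr ⟨η, h6, h7, ?_⟩
    rintro ⟨g, hg, h9, h10⟩
    exact h8 ⟨g, hML _ g hg h9, h9, h10⟩

/-- `M` is a guided family over `β + ω` whose part below `β` is `L`. -/
structure IsExtension (𝓟 : Set (Set ℕ)) (S : Bool → Ordinal.{0} → Set (Finset Ordinal.{0}))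
    (β : Ordinal.{0}) (L M : ∀ k, Set (Fin (τ.m k) → Ordinal.{0})) : Prop where
  isFamily : IsFamily τ M (β + ω)
  guided : Guided 𝓟 S M (β + ω)
  subset : ∀ k, L k ⊆ M k
  mem : ∀ k, ∀ f ∈ M k, (∀ x, f x < β) → f ∈ L k

open Classical in
/-- An extension of `L` from `β` to `β + ω`, if there is one. -/
noncomputable def extension (𝓟 : Set (Set ℕ)) (S : Bool → Ordinal.{0} → Set (Finset Ordinal.{0}))
    (β : Ordinal.{0}) (L : ∀ k, Set (Fin (τ.m k) → Ordinal.{0})) :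
    ∀ k, Set (Fin (τ.m k) → Ordinal.{0}) :=
  if h : ∃ M, IsExtension 𝓟 S β L M then h.choose else L

/-- The ordinal over which the `α`-th family of the recursion lives. -/
noncomputable def height (α : Ordinal.{0}) : Ordinal.{0} := ω * (1 + α)

/-- The recursively constructed families. -/
noncomputable def tower (τ : SchemeType) (𝓟 : Set (Set ℕ))
    (S : Bool → Ordinal.{0} → Set (Finset Ordinal.{0})) (α : Ordinal.{0}) :
    ∀ k, Set (Fin (τ.m k) → Ordinal.{0}) :=
  fun k => baseFamily τ k ∪
    {f | ∃ ξ, ∃ _ : ξ < α, f ∈ extension 𝓟 S (height ξ) (tower τ 𝓟 S ξ) k}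
termination_by α

theorem height_zero : height 0 = ω := by
  simp [height]

theorem height_add_one (α : Ordinal.{0}) : height (α + 1) = height α + ω := by
  rw [height, height, ← add_assoc, mul_add_one]

theorem height_mono {α β : Ordinal.{0}} (h : α ≤ β) : height α ≤ height β := by
  unfold height
  gcongr

theorem isSuccLimit_height (α : Ordinal.{0}) : Order.IsSuccLimit (height α) :=
  Ordinal.isSuccLimit_mul_left Ordinal.isSuccLimit_omega0 (zero_lt_one.trans_le le_self_add)

theorem exists_lt_height {α x : Ordinal.{0}} (hα : Order.IsSuccLimit α) (hx : x < height α) :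
    ∃ ξ < α, x < height ξ := by
  rw [height, Ordinal.one_add_of_omega0_le (Ordinal.omega0_le_of_isSuccLimit hα),
    Ordinal.lt_mul_iff_of_isSuccLimit hα] at hx
  obtain ⟨ξ, hξ, hx⟩ := hx
  refine ⟨ξ, hξ, hx.trans_le ?_⟩
  unfold height
  gcongr
  exact le_add_self

theorem height_omega_one : height ω₁ = ω₁ := by
  rw [height, Ordinal.one_add_of_omega0_le Ordinal.omega0_lt_omega_one.le]
  exact Ordinal.isPrincipal_mul_iff_mul_left_eq.1 (Ordinal.isPrincipal_mul_omega 1) _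
    Ordinal.omega0_pos Ordinal.omega0_lt_omega_one

theorem height_add_omega_lt {α : Ordinal.{0}} (h : α < ω₁) : height α + ω < ω₁ := by
  have h1 := Ordinal.omega0_lt_omega_one
  have h2 : (1 : Ordinal.{0}) < ω₁ := Ordinal.one_lt_omega0.trans h1
  refine Ordinal.isPrincipal_add_omega 1 ?_ h1
  exact Ordinal.isPrincipal_mul_omega 1 h1 (Ordinal.isPrincipal_add_omega 1 h2 h)

section Tower

variable {𝓟 : Set (Set ℕ)} {S : Bool → Ordinal.{0} → Set (Finset Ordinal.{0})}

theorem mem_tower {α : Ordinal.{0}} {k : ℕ} {f : Fin (τ.m k) → Ordinal.{0}} :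
    f ∈ tower τ 𝓟 S α k ↔ f ∈ baseFamily τ k ∨
      ∃ ξ < α, f ∈ extension 𝓟 S (height ξ) (tower τ 𝓟 S ξ) k := by
  rw [tower]
  simp

theorem tower_mono {α β : Ordinal.{0}} (h : α ≤ β) (k : ℕ) :
    tower τ 𝓟 S α k ⊆ tower τ 𝓟 S β k := by
  intro f hf
  rw [mem_tower] at hf ⊢
  exact hf.imp_right fun ⟨ξ, hξ, hf⟩ => ⟨ξ, hξ.trans_le h, hf⟩

theorem tower_zero : tower τ 𝓟 S 0 = baseFamily τ := by
  funext k
  ext f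
  rw [mem_tower]
  simp [not_lt_zero]

theorem isExtension_tower_add_one {α : Ordinal.{0}}
    (h : ∃ M, IsExtension 𝓟 S (height α) (tower τ 𝓟 S α) M) :
    IsExtension 𝓟 S (height α) (tower τ 𝓟 S α) (tower τ 𝓟 S (α + 1)) := by
  have he : IsExtension 𝓟 S (height α) (tower τ 𝓟 S α)
      (extension 𝓟 S (height α) (tower τ 𝓟 S α)) := by
    rw [extension, dif_pos h]
    exact h.choose_spec
  convert he
  funext k
  ext f
  refine ⟨fun hf => ?_, fun hf => mem_tower.2 (Or.inr ⟨α, Order.lt_add_one_iff.2 le_rfl, hf⟩)⟩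
  rcases mem_tower.1 hf with hb | ⟨ξ, hξ, he'⟩
  · exact he.subset k (mem_tower.2 (Or.inl hb))
  · rcases (Order.lt_add_one_iff.1 hξ).lt_or_eq with hξ | rfl
    · exact he.subset k (mem_tower.2 (Or.inr ⟨ξ, hξ, he'⟩))
    · exact he'

theorem exists_mem_tower {α : Ordinal.{0}} (hα : Order.IsSuccLimit α) {k : ℕ}
    {f : Fin (τ.m k) → Ordinal.{0}} (hf : f ∈ tower τ 𝓟 S α k) :
    ∃ ξ < α, f ∈ tower τ 𝓟 S ξ k := by
  rcases mem_tower.1 hf with hf | ⟨ξ, hξ, hf⟩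
  · exact ⟨0, hα.bot_lt, mem_tower.2 (Or.inl hf)⟩
  · exact ⟨ξ + 1, hα.succ_lt hξ,
      mem_tower.2 (Or.inr ⟨ξ, Order.lt_add_one_iff.2 le_rfl, hf⟩)⟩

theorem exists_forall_lt_height {α : Ordinal.{0}} (hα : Order.IsSuccLimit α)
    (A : Finset Ordinal.{0}) (hA : ∀ x ∈ A, x < height α) :
    ∃ ξ < α, ∀ x ∈ A, x < height ξ := by
  obtain ⟨ξ, hξ, h⟩ := exists_lt_height hα
    ((Finset.sup_lt_iff (f := id) (isSuccLimit_height α).bot_lt).2 hA)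
  exact ⟨ξ, hξ, fun x hx => (Finset.le_sup (f := id) hx).trans_lt h⟩

/-- The last clause says that no functions are added below an earlier height. It carries the
negative half of `Captured`, which concerns only functions below `δ`, through limit stages. -/
theorem tower_spec (h𝓟 : CompatiblePartition τ 𝓟)
    (hS : ∀ δ, S false δ = ∅) (hS' : ∀ b δ, ¬ Order.IsSuccLimit δ → S b δ = ∅)
    (α : Ordinal.{0}) (hα : α ≤ ω₁) :
    IsFamily τ (tower τ 𝓟 S α) (height α) ∧ Guided 𝓟 S (tower τ 𝓟 S α) (height α) ∧
      ∀ ξ < α, ∀ k, ∀ f ∈ tower τ 𝓟 S α k, (∀ x, f x < height ξ) → f ∈ tower τ 𝓟 S ξ k := by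
  induction α using Ordinal.limitRecOn with
  | zero =>
    rw [tower_zero, height_zero]
    exact ⟨isFamily_baseFamily, guided_baseFamily h𝓟 S, fun ξ hξ => absurd hξ not_lt_zero⟩
  | add_one α ih =>
    have hlt : α < ω₁ := (Order.lt_add_one_iff.2 le_rfl).trans_le hα
    obtain ⟨h1, h2, h3⟩ := ih hlt.le
    obtain ⟨M, hM1, hM2, hM3, hM4⟩ := exists_family_extension h𝓟.1 hS hS' (isSuccLimit_height α)
      (height_add_omega_lt hlt) h1 h2
    have he := isExtension_tower_add_one (α := α) ⟨M, hM1, hM2, hM3, hM4⟩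
    rw [height_add_one]
    refine ⟨he.isFamily, he.guided, fun ξ hξ k f hf hx => ?_⟩
    have hξ := Order.lt_add_one_iff.1 hξ
    have hf' := he.mem k f hf fun x => (hx x).trans_le (height_mono hξ)
    rcases hξ.lt_or_eq with hξ | rfl
    · exact h3 ξ hξ k f hf' hx
    · exact hf'
  | limit α hlim ih =>
    have hmem : ∀ ξ < α, ∀ k, ∀ f ∈ tower τ 𝓟 S α k, (∀ x, f x < height ξ) →
        f ∈ tower τ 𝓟 S ξ k := by
      intro ξ hξ k f hf hx
      obtain ⟨ζ, hζ, hf⟩ := exists_mem_tower hlim hf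
      rcases le_or_gt ζ ξ with h | h
      · exact tower_mono h k hf
      · exact (ih ζ hζ (hζ.le.trans hα)).2.2 ξ h k f hf hx
    refine ⟨⟨?_, ?_, ?_, ?_, ?_⟩, ?_, hmem⟩
    · intro k f hf
      obtain ⟨ξ, hξ, hf⟩ := exists_mem_tower hlim hf
      exact (ih ξ hξ (hξ.le.trans hα)).1.strictMono f hf
    · intro k f hf x
      obtain ⟨ξ, hξ, hf⟩ := exists_mem_tower hlim hf
      exact ((ih ξ hξ (hξ.le.trans hα)).1.lt f hf x).trans_le (height_mono hξ.le)
    · intro A hA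
      obtain ⟨ξ, hξ, hA⟩ := exists_forall_lt_height hlim A hA
      obtain ⟨k, f, hf, h⟩ := (ih ξ hξ (hξ.le.trans hα)).1.cover A hA
      exact ⟨k, f, tower_mono hξ.le k hf, h⟩
    · intro k f hf g hg
      obtain ⟨ξ, hξ, hf⟩ := exists_mem_tower hlim hf
      obtain ⟨ζ, hζ, hg⟩ := exists_mem_tower hlim hg
      have h := max_lt hξ hζ
      exact (ih _ h (h.le.trans hα)).1.coherent f (tower_mono (le_max_left _ _) k hf) g
        (tower_mono (le_max_right _ _) k hg)
    · intro k f hf i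
      obtain ⟨ξ, hξ, hf⟩ := exists_mem_tower hlim hf
      exact tower_mono hξ.le k ((ih ξ hξ (hξ.le.trans hα)).1.closed f hf i)
    · intro δ hδ b P hP A hA l h hh a ha q
      obtain ⟨ξ, hξ, hh⟩ := exists_mem_tower hlim hh
      obtain ⟨ζ, hζ, hA⟩ := exists_forall_lt_height hlim (insert δ A)
        (by simpa [hδ] using hA)
      have hm := max_lt hξ hζ
      have hA' : ∀ x ∈ insert δ A, x < height (max ξ ζ) := fun x hx =>
        (hA x hx).trans_le (height_mono (le_max_right _ _))
      have hδ' := hA' δ (by simp)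
      obtain ⟨k, hk, f, hf, H⟩ := (ih _ hm (hm.le.trans hα)).2.1 δ hδ' b P hP A
        (fun x hx => hA' x (by simp [hx])) l h (tower_mono (le_max_left _ _) l hh) a ha q
      exact ⟨k, hk, f, tower_mono hm.le _ hf, H.mono (tower_mono hm.le) fun k f hf hx =>
        hmem _ hm k f hf fun x => (hx x).trans hδ'⟩

end Tower

theorem exists_guided_family {𝓟 : Set (Set ℕ)} (h𝓟 : CompatiblePartition τ 𝓟)
    {S : Bool → Ordinal.{0} → Set (Finset Ordinal.{0})}
    (hS : ∀ δ, S false δ = ∅) (hS' : ∀ b δ, ¬ Order.IsSuccLimit δ → S b δ = ∅) :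
    ∃ L : ∀ k, Set (Fin (τ.m k) → Ordinal.{0}), IsFamily τ L ω₁ ∧ Guided 𝓟 S L ω₁ := by
  have h := tower_spec h𝓟 hS hS' ω₁ le_rfl
  rw [height_omega_one] at h
  exact ⟨_, h.1, h.2.1⟩

/-! ### From families of functions to families of finite sets -/

/-- The family of the ranges of the functions in `L`. -/
def ranges (L : ∀ k, Set (Fin (τ.m k) → Ordinal.{0})) : Set (Finset Ordinal.{0}) :=
  {F | ∃ k, ∃ f ∈ L k, F = Finset.univ.image f}

/-- The `i`-th piece of the range of `f`. -/
noncomputable def pieceSet {k : ℕ} (f : Fin (τ.m (k + 1)) → Ordinal.{0}) (i : ℕ) :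
    Finset Ordinal.{0} :=
  if h : i < τ.n (k + 1) then Finset.univ.image (f ∘ piece τ k ⟨i, h⟩) else ∅

/-- The root of the range of `f`. -/
noncomputable def rootSet {k : ℕ} (f : Fin (τ.m (k + 1)) → Ordinal.{0}) : Finset Ordinal.{0} :=
  Finset.univ.image fun x : Fin (τ.r (k + 1)) =>
    f ⟨x.1, x.2.trans ((τ.r_lt_m k).trans (τ.m_lt_m_succ k))⟩

theorem pieceSet_of_lt {k : ℕ} (f : Fin (τ.m (k + 1)) → Ordinal.{0}) {i : ℕ}
    (h : i < τ.n (k + 1)) : pieceSet f i = Finset.univ.image (f ∘ piece τ k ⟨i, h⟩) :=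
  dif_pos h

theorem apply_mem_rootSet {k : ℕ} {f : Fin (τ.m (k + 1)) → Ordinal.{0}} (hf : StrictMono f)
    {x : Fin (τ.m (k + 1))} : f x ∈ rootSet f ↔ x.1 < τ.r (k + 1) := by
  simp only [rootSet, Finset.mem_image, Finset.mem_univ, true_and]
  refine ⟨?_, fun h => ⟨⟨x.1, h⟩, rfl⟩⟩
  rintro ⟨y, hy⟩
  rw [← hf.injective hy]
  exact y.2

section Family

variable {L : ∀ k, Set (Fin (τ.m k) → Ordinal.{0})} {β : Ordinal.{0}}

theorem IsFamily.card_image (hL : IsFamily τ L β) {k : ℕ} {f : Fin (τ.m k) → Ordinal.{0}}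
    (hf : f ∈ L k) : (Finset.univ.image f).card = τ.m k := by
  rw [Finset.card_image_of_injective _ (hL.strictMono f hf).injective]
  simp

/-- Cardinality determines the level and grows with it, so proper subsets have lower level; the
first piece supplies a proper subset exactly one level down. -/
theorem IsFamily.rank_eq (hL : IsFamily τ L β) {k : ℕ} {f : Fin (τ.m k) → Ordinal.{0}}
    (hf : f ∈ L k) (h : Finset.univ.image f ∈ ranges L) :
    IsWellFounded.rank (fun A B : ranges L => A.1 ⊂ B.1) ⟨Finset.univ.image f, h⟩ = k := by
  induction k using Nat.strong_induction_on with
  | _ k ih =>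
    refine le_antisymm ?_ ?_
    · rw [IsWellFounded.rank_eq]
      refine Ordinal.iSup_le ?_
      rintro ⟨⟨G, hG⟩, hb⟩
      obtain ⟨j, g, hg, rfl⟩ := id hG
      have hcard := Finset.card_lt_card hb
      simp only [hL.card_image hf, hL.card_image hg] at hcard
      have hj := τ.m_strictMono.lt_iff_lt.1 hcard
      exact Order.succ_le_of_lt ((ih j hj hg hG).trans_lt (Nat.cast_lt.2 hj))
    · cases k with
      | zero => simp
      | succ k =>
        have hg := hL.closed f hf (τ.fst k)
        have hg' : Finset.univ.image (f ∘ piece τ k (τ.fst k)) ∈ ranges L := ⟨k, _, hg, rfl⟩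
        have hlt := IsWellFounded.rank_lt_of_rel
          (r := fun A B : ranges L => A.1 ⊂ B.1) (a := ⟨_, hg'⟩) (b := ⟨_, h⟩) (by
            refine Finset.ssubset_iff_subset_ne.2 ⟨?_, fun heq => ?_⟩
            · intro x hx
              obtain ⟨y, -, rfl⟩ := Finset.mem_image.1 hx
              exact Finset.mem_image_of_mem _ (Finset.mem_univ _)
            · have hcard := congrArg Finset.card heq
              simp only [hL.card_image hf, hL.card_image hg] at hcard
              exact (τ.m_lt_m_succ k).ne hcard)
        rw [ih k (Nat.lt_succ_self k) hg hg'] at hlt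
        rw [Nat.cast_succ]
        exact Order.add_one_le_of_lt hlt

theorem IsFamily.mem_level (hL : IsFamily τ L β) {k : ℕ} {F : Finset Ordinal.{0}} :
    F ∈ level (ranges L) k ↔ ∃ f ∈ L k, F = Finset.univ.image f := by
  constructor
  · rintro ⟨h, hr⟩
    obtain ⟨j, f, hf, rfl⟩ := id h
    rw [hL.rank_eq hf h, Nat.cast_inj] at hr
    subst hr
    exact ⟨f, hf, rfl⟩
  · rintro ⟨f, hf, rfl⟩
    exact ⟨⟨k, f, hf, rfl⟩, hL.rank_eq hf _⟩

theorem IsFamily.isCanonicalDecomposition (hL : IsFamily τ L β) {k : ℕ}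
    {f : Fin (τ.m (k + 1)) → Ordinal.{0}} (hf : f ∈ L (k + 1)) :
    IsCanonicalDecomposition τ (ranges L) k (Finset.univ.image f) (pieceSet f) (rootSet f) := by
  have hmono := hL.strictMono f hf
  have hrm := τ.r_lt_m k
  refine ⟨fun i hi => ?_, ?_, fun i hi j hj hij => ?_, fun i hi j hj hij => ?_, ?_, ?_, ?_⟩
  · rw [pieceSet_of_lt f hi]
    exact hL.mem_level.2 ⟨_, hL.closed f hf _, rfl⟩
  · ext x
    simp only [Finset.mem_image, Finset.mem_univ, true_and, Finset.mem_biUnion, Finset.mem_range]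
    constructor
    · rintro ⟨y, rfl⟩
      obtain ⟨i, z, rfl⟩ := exists_piece_eq y
      exact ⟨i.1, i.2, by rw [pieceSet_of_lt f i.2]; simp⟩
    · rintro ⟨i, hi, hx⟩
      rw [pieceSet_of_lt f hi] at hx
      obtain ⟨z, -, rfl⟩ := Finset.mem_image.1 hx
      exact ⟨_, rfl⟩
  · rw [Set.mem_Iio] at hi hj
    rw [pieceSet_of_lt f hi, pieceSet_of_lt f hj] at hij
    have : f (piece τ k ⟨i, hi⟩ ⟨τ.r (k + 1), hrm⟩) ∈
        Finset.univ.image (f ∘ piece τ k ⟨j, hj⟩) := by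
      rw [← hij]
      exact Finset.mem_image_of_mem _ (Finset.mem_univ _)
    obtain ⟨z, -, hz⟩ := Finset.mem_image.1 this
    exact congrArg Fin.val ((piece_eq_piece (hmono.injective hz.symm)).2 le_rfl)
  · rw [pieceSet_of_lt f hi, pieceSet_of_lt f hj]
    ext x
    rw [Finset.mem_inter]
    constructor
    · rintro ⟨h1, h2⟩
      obtain ⟨y, -, rfl⟩ := Finset.mem_image.1 h1
      obtain ⟨z, -, hz⟩ := Finset.mem_image.1 h2
      rw [Function.comp_apply, apply_mem_rootSet hmono, piece_val_lt_r_iff]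
      by_contra hy
      exact hij (congrArg Fin.val ((piece_eq_piece (hmono.injective hz.symm)).2 (not_lt.1 hy)))
    · intro hx
      obtain ⟨y, -, rfl⟩ := Finset.mem_image.1 hx
      have : ∀ i, piece τ k i ⟨y.1, y.2.trans hrm⟩ =
          ⟨y.1, y.2.trans (hrm.trans (τ.m_lt_m_succ k))⟩ :=
        fun i => Fin.ext (piece_val_of_lt i y.2)
      exact ⟨Finset.mem_image.2 ⟨_, Finset.mem_univ _, congrArg f (this _)⟩,
        Finset.mem_image.2 ⟨_, Finset.mem_univ _, congrArg f (this _)⟩⟩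
  · rw [rootSet, Finset.card_image_of_injective]
    · simp
    · intro x y hxy
      exact Fin.ext (Fin.mk.inj_iff.1 (hmono.injective hxy))
  · intro x hx y hy
    obtain ⟨hy1, hy2⟩ := Finset.mem_sdiff.1 hy
    rw [pieceSet_of_lt f (i := 0) (τ.fst k).2] at hy1
    obtain ⟨z, -, rfl⟩ := Finset.mem_image.1 hy1
    obtain ⟨w, -, rfl⟩ := Finset.mem_image.1 hx
    rw [Function.comp_apply, apply_mem_rootSet hmono, not_lt] at hy2
    exact hmono (Fin.lt_def.2 (w.2.trans_le hy2))
  · intro i j hij hj x hx y hy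
    obtain ⟨hx1, -⟩ := Finset.mem_sdiff.1 hx
    obtain ⟨hy1, hy2⟩ := Finset.mem_sdiff.1 hy
    rw [pieceSet_of_lt f (hij.trans hj)] at hx1
    rw [pieceSet_of_lt f hj] at hy1
    obtain ⟨z, -, rfl⟩ := Finset.mem_image.1 hx1
    obtain ⟨w, -, rfl⟩ := Finset.mem_image.1 hy1
    rw [Function.comp_apply, apply_mem_rootSet hmono, piece_val_lt_r_iff, not_lt] at hy2
    exact hmono (piece_lt_piece (Fin.lt_def.2 hij) z hy2)

/-- The last value of `g` lies in some piece, and coherence there identifies `g` with that piece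
entirely. -/
theorem IsFamily.exists_eq_piece (hL : IsFamily τ L β) {k : ℕ}
    {f : Fin (τ.m (k + 1)) → Ordinal.{0}} (hf : f ∈ L (k + 1)) {g : Fin (τ.m k) → Ordinal.{0}}
    (hg : g ∈ L k) (h : ∀ x, ∃ y, f y = g x) : ∃ i, g = f ∘ piece τ k i := by
  have hpos := τ.m_pos k
  obtain ⟨y, hy⟩ := h ⟨τ.m k - 1, by omega⟩
  obtain ⟨i, z, rfl⟩ := exists_piece_eq y
  obtain ⟨-, h2⟩ := hL.coherent g hg _ (hL.closed f hf i) _ z hy.symm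
  refine ⟨i, funext fun x => h2 x ?_⟩
  have := x.2
  rw [Fin.le_def]
  simp only
  omega

theorem IsFamily.isConstructionScheme (hL : IsFamily τ L β) :
    IsConstructionScheme τ (Set.Iio β) (ranges L) where
  subset := by
    rintro _ ⟨k, f, hf, rfl⟩ x hx
    obtain ⟨y, -, rfl⟩ := Finset.mem_image.1 (Finset.mem_coe.1 hx)
    exact hL.lt f hf y
  cofinal A hA := by
    obtain ⟨k, f, hf, h⟩ := hL.cover A fun x hx => hA (Finset.mem_coe.2 hx)
    refine ⟨_, ⟨k, f, hf, rfl⟩, fun x hx => ?_⟩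
    obtain ⟨j, rfl⟩ := h x hx
    exact Finset.mem_image_of_mem _ (Finset.mem_univ _)
  card_eq k F hF := by
    obtain ⟨f, hf, rfl⟩ := hL.mem_level.1 hF
    exact hL.card_image hf
  inter_initial k F hF E hE := by
    have key : ∀ f ∈ L k, ∀ g ∈ L k, ∀ c ∈ Finset.univ.image f ∩ Finset.univ.image g,
        ∀ d ∈ Finset.univ.image f, d ≤ c → d ∈ Finset.univ.image f ∩ Finset.univ.image g := by
      intro f hf g hg c hc d hd hdc
      obtain ⟨h1, h2⟩ := Finset.mem_inter.1 hc
      obtain ⟨a, -, rfl⟩ := Finset.mem_image.1 h1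
      obtain ⟨b, -, hb⟩ := Finset.mem_image.1 h2
      obtain ⟨x, -, rfl⟩ := Finset.mem_image.1 hd
      obtain ⟨-, h3⟩ := hL.coherent f hf g hg a b hb.symm
      refine Finset.mem_inter.2 ⟨hd, ?_⟩
      rw [h3 x ((hL.strictMono f hf).le_iff_le.1 hdc)]
      exact Finset.mem_image_of_mem _ (Finset.mem_univ _)
    obtain ⟨f, hf, rfl⟩ := hL.mem_level.1 hF
    obtain ⟨g, hg, rfl⟩ := hL.mem_level.1 hE
    refine ⟨⟨Finset.inter_subset_left, key g hg f hf⟩, ⟨Finset.inter_subset_right, ?_⟩⟩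
    rw [Finset.inter_comm]
    exact key f hf g hg
  decomposition k F hF := by
    obtain ⟨f, hf, rfl⟩ := hL.mem_level.1 hF
    have hmono := hL.strictMono f hf
    refine ⟨_, _, hL.isCanonicalDecomposition hf, fun e he hU => ?_⟩
    have hsub : ∀ i < τ.n (k + 1), ∃ j : Fin (τ.n (k + 1)), e i = pieceSet f j := by
      intro i hi
      obtain ⟨g, hg, hgi⟩ := hL.mem_level.1 (he i hi)
      obtain ⟨j, rfl⟩ := hL.exists_eq_piece hf hg (fun x => by
        have : g x ∈ Finset.univ.image f := by
          rw [hU, Finset.mem_biUnion]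
          refine ⟨i, Finset.mem_range.2 hi, ?_⟩
          rw [hgi]
          exact Finset.mem_image_of_mem _ (Finset.mem_univ _)
        obtain ⟨y, -, hy⟩ := Finset.mem_image.1 this
        exact ⟨y, hy⟩)
      exact ⟨j, by rw [hgi, pieceSet_of_lt f j.2]⟩
    ext s
    simp only [Finset.mem_image, Finset.mem_range]
    constructor
    · rintro ⟨i, hi, rfl⟩
      obtain ⟨j, hj⟩ := hsub i hi
      exact ⟨j, j.2, hj.symm⟩
    · rintro ⟨j, hj, rfl⟩
      -- The first point of a piece beyond the root lies in no other piece, so any decomposition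
      -- must use this piece.
      have : f (piece τ k ⟨j, hj⟩ ⟨τ.r (k + 1), τ.r_lt_m k⟩) ∈ Finset.univ.image f :=
        Finset.mem_image_of_mem _ (Finset.mem_univ _)
      rw [hU, Finset.mem_biUnion] at this
      obtain ⟨i, hi, hx⟩ := this
      obtain ⟨j', hj'⟩ := hsub i (Finset.mem_range.1 hi)
      refine ⟨i, Finset.mem_range.1 hi, ?_⟩
      rw [hj', pieceSet_of_lt f j'.2] at hx
      obtain ⟨z, -, hz⟩ := Finset.mem_image.1 hx
      have h1 := (piece_eq_piece (hmono.injective hz.symm)).2 le_rfl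
      rw [hj', ← Fin.mk.inj_iff.1 h1]

/-- The position `y` beyond the root makes the captured sets pairwise distinct and not contained in
the root; since all occupy the same positions `p`, the increasing bijections between pieces match
them. -/
theorem IsFamily.exists_fullyCaptures (hL : IsFamily τ L β) {k : ℕ}
    {g : Fin (τ.m (k + 1)) → Ordinal.{0}} (hg : g ∈ L (k + 1)) {p : Finset (Fin (τ.m k))}
    {y : Fin (τ.m k)} (hy : y ∈ p) (hry : τ.r (k + 1) ≤ y.1) {T : Set (Finset Ordinal.{0})}
    (hT : ∀ j, p.image (g ∘ piece τ k j) ∈ T) :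
    ∃ 𝓒 : Finset (Finset Ordinal.{0}), (𝓒 : Set (Finset Ordinal.{0})) ⊆ T ∧
      FullyCaptures τ (ranges L) (k + 1) (Finset.univ.image g) 𝓒 := by
  have hmono := hL.strictMono g hg
  let c : ℕ → Finset Ordinal.{0} := fun i =>
    if h : i < τ.n (k + 1) then p.image (g ∘ piece τ k ⟨i, h⟩) else ∅
  have hc : ∀ i (h : i < τ.n (k + 1)), c i = p.image (g ∘ piece τ k ⟨i, h⟩) := fun i h => dif_pos h
  have hcard : ((Finset.range (τ.n (k + 1))).image c).card = τ.n (k + 1) := by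
    rw [Finset.card_image_of_injOn, Finset.card_range]
    intro i hi j hj hij
    rw [Finset.coe_range, Set.mem_Iio] at hi hj
    have : g (piece τ k ⟨i, hi⟩ y) ∈ c j := by
      rw [← hij, hc i hi]
      exact Finset.mem_image_of_mem _ hy
    rw [hc j hj] at this
    obtain ⟨z, -, hz⟩ := Finset.mem_image.1 this
    exact congrArg Fin.val ((piece_eq_piece (hmono.injective hz.symm)).2 hry)
  refine ⟨(Finset.range (τ.n (k + 1))).image c, ?_, ⟨⟨hL.mem_level.2 ⟨g, hg, rfl⟩, hcard.le, k,
    pieceSet g, rootSet g, c, rfl, hL.isCanonicalDecomposition hg, by rw [hcard], ?_⟩, hcard.symm⟩⟩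
  · intro s hs
    obtain ⟨i, hi, rfl⟩ := Finset.mem_image.1 (Finset.mem_coe.1 hs)
    rw [hc i (Finset.mem_range.1 hi)]
    exact hT _
  · rw [hcard]
    intro i hi
    have h0 := (τ.fst k).2
    have : Nonempty (Fin (τ.m k)) := ⟨y⟩
    have hinv : Function.LeftInverse (Function.invFun (g ∘ piece τ k (τ.fst k)))
        (g ∘ piece τ k (τ.fst k)) :=
      Function.leftInverse_invFun (hmono.comp (piece_strictMono k _)).injective
    have hφ : ∀ x, (g ∘ piece τ k ⟨i, hi⟩) (Function.invFun (g ∘ piece τ k (τ.fst k))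
        ((g ∘ piece τ k (τ.fst k)) x)) = (g ∘ piece τ k ⟨i, hi⟩) x := fun x =>
      congrArg _ (hinv x)
    have hm0 := hmono.comp (piece_strictMono k (τ.fst k))
    have hmi := hmono.comp (piece_strictMono k ⟨i, hi⟩)
    have hc0 : c 0 = p.image (g ∘ piece τ k (τ.fst k)) := hc 0 h0
    have hd0 : pieceSet g 0 = Finset.univ.image (g ∘ piece τ k (τ.fst k)) := pieceSet_of_lt g h0
    rw [hc i hi, hc0, hd0, pieceSet_of_lt g hi]
    refine ⟨Finset.image_subset_image (Finset.subset_univ _), ⟨g (piece τ k ⟨i, hi⟩ y), ?_⟩,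
      (g ∘ piece τ k ⟨i, hi⟩) ∘ Function.invFun (g ∘ piece τ k (τ.fst k)), ?_, ⟨?_, ?_, ?_⟩, ?_⟩
    · rw [Finset.mem_sdiff, apply_mem_rootSet hmono, piece_val_lt_r_iff, not_lt]
      exact ⟨Finset.mem_image_of_mem (g ∘ piece τ k ⟨i, hi⟩) hy, hry⟩
    · intro u hu v hv huv
      obtain ⟨u, -, rfl⟩ := Finset.mem_image.1 (Finset.mem_coe.1 hu)
      obtain ⟨v, -, rfl⟩ := Finset.mem_image.1 (Finset.mem_coe.1 hv)
      refine (hφ u).trans_lt (lt_of_lt_of_eq ?_ (hφ v).symm)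
      exact hmi (hm0.lt_iff_lt.1 huv)
    · intro u hu
      obtain ⟨u, -, rfl⟩ := Finset.mem_image.1 (Finset.mem_coe.1 hu)
      exact Finset.mem_coe.2 (Finset.mem_image_of_mem _ (Finset.mem_univ _))
    · intro u hu v hv huv
      obtain ⟨u, -, rfl⟩ := Finset.mem_image.1 (Finset.mem_coe.1 hu)
      obtain ⟨v, -, rfl⟩ := Finset.mem_image.1 (Finset.mem_coe.1 hv)
      exact congrArg _ (hmi.injective ((hφ u).symm.trans (huv.trans (hφ v))))
    · intro u hu
      obtain ⟨u, -, rfl⟩ := Finset.mem_image.1 (Finset.mem_coe.1 hu)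
      exact ⟨_, Finset.mem_coe.2 (Finset.mem_image_of_mem _ (Finset.mem_univ u)), hφ u⟩
    · rw [Finset.image_image]
      exact Finset.image_congr fun x _ => hφ x

end Family

/-! ### Guessing -/

theorem exists_code : ∃ code : Finset Ordinal.{0} → Ordinal.{0}, (∀ s, code s < ω₁) ∧
    Set.InjOn code {s | (s : Set Ordinal.{0}) ⊆ Set.Iio ω₁} := by
  classical
  have hinf : Infinite (Set.Iio (ω₁ : Ordinal.{0})) := by
    rw [← Cardinal.aleph0_le_mk_iff, Cardinal.mk_Iio_ordinal]
    simp
  obtain ⟨e⟩ := Cardinal.eq.1 (Cardinal.mk_finset_of_infinite (Set.Iio (ω₁ : Ordinal.{0})))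
  refine ⟨fun s => (e (s.subtype (· ∈ Set.Iio ω₁))).1, fun s => (e _).2, fun s hs t ht hst => ?_⟩
  have h := e.injective (Subtype.ext hst)
  have := congrArg (Finset.map (Function.Embedding.subtype _)) h
  rwa [Finset.subtype_map, Finset.subtype_map, Finset.filter_true_of_mem fun x hx => hs hx,
    Finset.filter_true_of_mem fun x hx => ht hx] at this

/-- The families of finite sets guessed by the sequence `D`. -/
def guess (code : Finset Ordinal.{0} → Ordinal.{0}) (D : Ordinal.{0} → Set Ordinal.{0}) (b : Bool)
    (δ : Ordinal.{0}) : Set (Finset Ordinal.{0}) :=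
  {s | b = true ∧ Order.IsSuccLimit δ ∧ code s ∈ D δ}

/-- Unboundedness: iterate, `ω` times, a function dominating `Φ` on initial segments; the supremum
is countable and closed under `Φ`. -/
theorem isClub_closed {Φ : Ordinal.{0} → Ordinal.{0}} (hΦ : ∀ α < ω₁, Φ α < ω₁) :
    IsClub {γ : Set.Iio (ω₁ : Ordinal.{0}) | ∀ α < γ.1, Φ α < γ.1} := by
  have hsucc : ∀ α : Ordinal.{0}, α < ω₁ → α + 1 < ω₁ := fun α hα =>
    (Cardinal.isSuccLimit_omega 1).succ_lt hα
  refine ⟨fun d hd _ _ a ha α hα => ?_, fun x => ?_⟩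
  · obtain ⟨b, hb, hαb⟩ := (lt_isLUB_iff ha).1 (show (⟨α, hα.trans a.2⟩ : Set.Iio ω₁) < a from hα)
    exact (hd hb α hαb).trans_le (ha.1 hb)
  · let Ψ : Ordinal.{0} → Ordinal.{0} := fun α => ⨆ ξ : Set.Iio (α + 1), (Φ ξ.1 + 1)
    have hΨ : ∀ α < ω₁, Ψ α < ω₁ := fun α hα => by
      have := countable_Iio_of_lt_omega_one (hsucc α hα)
      exact Ordinal.iSup_lt_omega_one fun ξ => hsucc _ (hΦ _ (lt_trans ξ.2 (hsucc α hα)))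
    have hΦΨ : ∀ α < ω₁, ∀ ξ ≤ α, Φ ξ < Ψ α := fun α hα ξ hξ => by
      refine (Order.lt_add_one_iff.2 le_rfl).trans_le
        (le_ciSup (f := fun ξ : Set.Iio (α + 1) => Φ ξ.1 + 1) ⟨ω₁, ?_⟩
          ⟨ξ, Order.lt_add_one_iff.2 hξ⟩)
      rintro _ ⟨ζ, rfl⟩
      exact (hsucc _ (hΦ _ (lt_trans ζ.2 (hsucc α hα)))).le
    let u : ℕ → Ordinal.{0} := fun n => Nat.rec x.1 (fun _ α => max α (Ψ α)) n
    have hu : ∀ n, u n < ω₁ := fun n => by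
      induction n with
      | zero => exact x.2
      | succ n ih => exact max_lt ih (hΨ _ ih)
    have hle : ∀ n, u n ≤ ⨆ n, u n := fun n =>
      le_ciSup ⟨ω₁, by rintro _ ⟨n, rfl⟩; exact (hu n).le⟩ n
    refine ⟨⟨⨆ n, u n, Ordinal.iSup_lt_omega_one hu⟩, fun α hα => ?_, hle 0⟩
    obtain ⟨n, hn⟩ := (Ordinal.lt_iSup_iff).1 hα
    exact ((hΦΨ _ (hu n) α hn.le).trans_le (le_max_right _ _)).trans_le (hle (n + 1))

/-- Witnesses for the existence of functions capturing members of `T` can be found below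
a countable ordinal depending only on a bound for the parameters. -/
theorem exists_witness_bound {L : ∀ k, Set (Fin (τ.m k) → Ordinal.{0})} (hL : IsFamily τ L ω₁)
    {code : Finset Ordinal.{0} → Ordinal.{0}} (hcode : ∀ s, code s < ω₁)
    (T : Set (Finset Ordinal.{0})) {α : Ordinal.{0}} (hα : α < ω₁) :
    ∃ B < ω₁, ∀ k, ∀ f ∈ L (k + 1), ∀ (i : Fin (τ.n (k + 1))) (p : Finset (Fin (τ.m k))),
      (∀ x : Fin (τ.m (k + 1)), x.1 < τ.r (k + 1) → f x ≤ α) →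
      (∀ j ≤ i, p.image (f ∘ piece τ k j) ∈ T) →
      ∀ η ≤ α, (∀ x : Fin (τ.m (k + 1)), τ.r (k + 1) ≤ x.1 → η ≤ f x) →
      ∃ g ∈ L (k + 1), (∀ x, g x < B) ∧
        (∀ x : Fin (τ.m (k + 1)), x.1 < τ.r (k + 1) → g x = f x) ∧
        (∀ x : Fin (τ.m (k + 1)), τ.r (k + 1) ≤ x.1 → η ≤ g x) ∧
        ∀ j ≤ i, p.image (g ∘ piece τ k j) ∈ T ∧ code (p.image (g ∘ piece τ k j)) < B := by
  classical
  have hlim := Cardinal.isSuccLimit_omega 1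
  have := countable_Iio_of_lt_omega_one (hlim.succ_lt hα)
  -- Only the root values of `f` matter, so with everything bounded by `α` there are countably many
  -- parameters, and the bounds for chosen witnesses have a countable supremum.
  let J := Σ k, Fin (τ.n (k + 1)) × Finset (Fin (τ.m k)) ×
    (Fin (τ.m (k + 1)) → Set.Iio (Order.succ α)) × Set.Iio (Order.succ α)
  let good : ∀ t : J, (Fin (τ.m (t.1 + 1)) → Ordinal.{0}) → Prop := fun ⟨k, i, p, R, η⟩ g =>
    g ∈ L (k + 1) ∧ (∀ x : Fin (τ.m (k + 1)), x.1 < τ.r (k + 1) → g x = R x) ∧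
      (∀ x : Fin (τ.m (k + 1)), τ.r (k + 1) ≤ x.1 → η.1 ≤ g x) ∧
      ∀ j ≤ i, p.image (g ∘ piece τ k j) ∈ T
  have hbound : ∀ t : J, ∃ B < ω₁, (∃ g, good t g) → ∃ g, good t g ∧ (∀ x, g x < B) ∧
      ∀ j, code (t.2.2.1.image (g ∘ piece τ t.1 j)) < B := by
    intro t
    by_cases h : ∃ g, good t g
    · obtain ⟨g, hg⟩ := h
      have hgL : g ∈ L (t.1 + 1) := hg.1
      let A := Finset.univ.image g ∪
        Finset.univ.image fun j => code (t.2.2.1.image (g ∘ piece τ t.1 j))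
      refine ⟨Order.succ (A.sup id), hlim.succ_lt ((Finset.sup_lt_iff hlim.bot_lt).2 ?_),
        fun _ => ⟨g, hg, fun x => ?_, fun j => ?_⟩⟩
      · intro x hx
        rcases Finset.mem_union.1 hx with hx | hx
        · obtain ⟨y, -, rfl⟩ := Finset.mem_image.1 hx
          exact hL.lt g hgL y
        · obtain ⟨y, -, rfl⟩ := Finset.mem_image.1 hx
          exact hcode _
      · exact Order.lt_succ_of_le (Finset.le_sup (f := id)
          (Finset.mem_union_left _ (Finset.mem_image_of_mem _ (Finset.mem_univ x))))
      · exact Order.lt_succ_of_le (Finset.le_sup (f := id)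
          (Finset.mem_union_right _ (Finset.mem_image_of_mem _ (Finset.mem_univ j))))
    · exact ⟨0, hlim.bot_lt, fun h' => absurd h' h⟩
  choose B hB hBg using hbound
  refine ⟨⨆ t, B t, Ordinal.iSup_lt_omega_one hB, ?_⟩
  intro k f hf i p hfα hfT η hη hfη
  have hle : ∀ t, B t ≤ ⨆ t, B t := fun t =>
    le_ciSup ⟨ω₁, by rintro _ ⟨n, rfl⟩; exact (hB n).le⟩ t
  -- The value `0` is a default, taken only at positions beyond the root, which `good` does not
  -- compare with `R`.
  let t : J := ⟨k, i, p, fun x => if h : f x ≤ α then ⟨f x, Order.lt_succ_of_le h⟩ else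
    ⟨0, Order.lt_succ_of_le (zero_le (a := α))⟩, ⟨η, Order.lt_succ_of_le hη⟩⟩
  have hR : ∀ x : Fin (τ.m (k + 1)), x.1 < τ.r (k + 1) → f x = (t.2.2.2.1 x).1 := fun x hx => by
    simp only [t, dif_pos (hfα x hx)]
  obtain ⟨g, ⟨hg, h1, h2, h3⟩, h4, h5⟩ := hBg t ⟨f, hf, hR, hfη, hfT⟩
  exact ⟨g, hg, fun x => (h4 x).trans_le (hle t), fun x hx => (h1 x hx).trans (hR x hx).symm, h2,
    fun j hj => ⟨h3 j hj, (h5 j).trans_le (hle t)⟩⟩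

theorem isPartitionFullyCapturing {𝓟 : Set (Set ℕ)} {D : Ordinal.{0} → Set Ordinal.{0}}
    (hD : IsDiamondSequence D) {code : Finset Ordinal.{0} → Ordinal.{0}}
    (hcode : ∀ s, code s < ω₁)
    (hinj : Set.InjOn code {s | (s : Set Ordinal.{0}) ⊆ Set.Iio ω₁})
    {L : ∀ k, Set (Fin (τ.m k) → Ordinal.{0})} (hL : IsFamily τ L ω₁)
    (hG : Guided 𝓟 (guess code D) L ω₁) :
    IsPartitionFullyCapturing τ 𝓟 (ranges L) := by
  intro T hT hTunc P hP k₀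
  choose! Φ hΦ hΦspec using fun α (hα : α < ω₁) => exists_witness_bound hL hcode T hα
  obtain ⟨⟨γ, hγ⟩, ⟨hlim, hED⟩, hcl⟩ := hD.2 (code '' T)
    (by rintro _ ⟨s, -, rfl⟩; exact hcode s) (isClub_closed hΦ)
  dsimp only at hlim hED hcl
  rw [Set.mem_Iio] at hγ
  -- The countable ordinal `γ` has only countably many finite subsets, and `T` is uncountable.
  obtain ⟨s, hs, hsγ⟩ : ∃ s ∈ T, ¬ (s : Set Ordinal.{0}) ⊆ Set.Iio γ := by
    by_contra! H
    have := Set.countable_ofPred_finite_subset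
      (Set.countable_coe_iff.1 (countable_Iio_of_lt_omega_one hγ))
    refine hTunc ((this.preimage_of_injOn (f := fun s : Finset Ordinal.{0} => (s : Set Ordinal.{0}))
      Finset.coe_injective.injOn).mono fun s hs => ?_)
    exact ⟨s.finite_toSet, H s hs⟩
  obtain ⟨ζ, hζs, hζγ⟩ := Set.not_subset.1 hsγ
  rw [Set.mem_Iio, not_lt] at hζγ
  obtain ⟨l, h, hh, hsh⟩ := hL.cover s fun x hx => hT s hs hx
  obtain ⟨z, rfl⟩ := hsh ζ hζs
  have hpos := τ.m_pos l
  have hlast : ∀ x : Fin (τ.m l), x ≤ ⟨τ.m l - 1, by omega⟩ := fun x => by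
    have := x.2
    rw [Fin.le_def]
    simp only
    omega
  let q := Finset.univ.filter fun x => h x ∈ s
  have hq : q.image h = s := by
    ext x
    simp only [q, Finset.mem_image, Finset.mem_filter, Finset.mem_univ, true_and]
    refine ⟨?_, fun hx => ?_⟩
    · rintro ⟨y, hy, rfl⟩
      exact hy
    · obtain ⟨y, rfl⟩ := hsh x hx
      exact ⟨y, hx, rfl⟩
  -- More than `τ.m k₀` points in one piece force its level above `k₀`.
  let A : Finset Ordinal.{0} := (Finset.range (τ.m k₀ + 1)).image Nat.cast
  obtain ⟨k, hk, f, hf, φ, -, -, i, h1, h2, h3, h4, h5⟩ := hG γ hγ true P hP A (by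
      intro x hx
      obtain ⟨n, -, rfl⟩ := Finset.mem_image.1 hx
      exact (Ordinal.natCast_lt_omega0 n).trans Ordinal.omega0_lt_omega_one)
    l h hh ⟨τ.m l - 1, by omega⟩ (hζγ.trans ((hL.strictMono h hh).monotone (hlast z))) q
  have hk₀ : k₀ < k + 1 := by
    have hcard : A.card ≤ (Finset.univ.image (f ∘ piece τ k i)).card := by
      refine Finset.card_le_card fun x hx => ?_
      obtain ⟨j, rfl⟩ := h2 x hx
      exact Finset.mem_image_of_mem (f ∘ piece τ k i) (Finset.mem_univ j)
    rw [hL.card_image (hL.closed f hf i), Finset.card_image_of_injective _ Nat.cast_injective,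
      Finset.card_range] at hcard
    exact (τ.m_strictMono.lt_iff_lt.1 hcard).trans (Nat.lt_succ_self k)
  have hps : (q.image φ).image (f ∘ piece τ k i) = s := by
    rw [Finset.image_image, ← hq]
    exact Finset.image_congr fun x _ => h1 x (hlast x)
  have hzp : φ z ∈ q.image φ :=
    Finset.mem_image_of_mem _ (Finset.mem_filter.2 ⟨Finset.mem_univ _, hζs⟩)
  have hrz : τ.r (k + 1) ≤ (φ z).1 := by
    rw [← not_lt, ← h3, h1 z (hlast z), not_lt]
    exact hζγ
  have hguess : ∀ f ∈ L (k + 1), ∀ j, (q.image φ).image (f ∘ piece τ k j) ∈ guess code D true γ →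
      (q.image φ).image (f ∘ piece τ k j) ∈ T := by
    rintro f hf j ⟨-, -, hj⟩
    rw [← hED] at hj
    obtain ⟨⟨s', hs', heq⟩, -⟩ := hj
    rwa [← hinj (hT s' hs') (fun x hx => ?_) heq]
    obtain ⟨y, -, rfl⟩ := Finset.mem_image.1 (Finset.mem_coe.1 hx)
    exact hL.lt f hf _
  rcases h5 with ⟨g, hg, -, hgj⟩ | ⟨η, hη, hηf, hno⟩
  · obtain ⟨𝓒, h𝓒, hcap⟩ := hL.exists_fullyCaptures hg hzp hrz fun j => hguess g hg j (hgj j)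
    exact ⟨𝓒, h𝓒, k + 1, hk, hk₀, _, hcap.1.1, hcap⟩
  · exfalso
    have hγ0 := hlim.bot_lt
    replace hη := hη hγ0.ne'
    have hroot : ∀ x : Fin (τ.m (k + 1)), x.1 < τ.r (k + 1) → f x < γ := fun x hx => by
      have : piece τ k i ⟨x.1, hx.trans (τ.r_lt_m k)⟩ = x := Fin.ext (piece_val_of_lt i hx)
      rw [← this, h3]
      exact hx
    let α := max η ((Finset.univ.filter fun x : Fin (τ.m (k + 1)) => x.1 < τ.r (k + 1)).sup f)
    have hα : α < γ := max_lt hη ((Finset.sup_lt_iff hγ0).2 fun x hx =>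
      hroot x (Finset.mem_filter.1 hx).2)
    -- Reflection: root values and `η` are bounded by `α < γ`, and the pieces of `f` up to `i` give
    -- members of `T`, the `i`-th one being `s`. Closure of `γ` yields such a function below `γ`,
    -- with codes below `γ`, so the captured sets belong to the guess.
    obtain ⟨g, hg, h6, h7, h8, h9⟩ := hΦspec α (hα.trans hγ) k f hf i (q.image φ)
      (fun x hx => (Finset.le_sup (f := f)
        (Finset.mem_filter.2 ⟨Finset.mem_univ x, hx⟩)).trans (le_max_right _ _))
      (fun j hj => by
        rcases hj.lt_or_eq with hj | rfl
        · exact hguess f hf j (h4 j hj)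
        · rwa [hps])
      η (le_max_left _ _) hηf
    refine hno ⟨g, hg, fun x => (h6 x).trans (hcl α hα), h7, h8, fun j hj => ⟨rfl, hlim, ?_⟩⟩
    rw [← hED]
    exact ⟨⟨_, (h9 j hj).1, rfl⟩, (h9 j hj).2.trans (hcl α hα)⟩

theorem Diamond.fcaPart (h : Diamond) : FCAPart := by
  obtain ⟨D, hD⟩ := h
  obtain ⟨code, hcode, hinj⟩ := exists_code
  intro τ 𝓟 h𝓟
  obtain ⟨L, hL, hG⟩ := exists_guided_family h𝓟 (S := guess code D)
    (fun δ => by simp [guess]) (fun b δ hδ => by simp [guess, hδ])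
  exact ⟨ranges L, hL.isConstructionScheme, isPartitionFullyCapturing hD hcode hinj hL hG⟩

theorem FCAPart.fca (h : FCAPart) : FCA := by
  intro τ
  refine h τ {Set.univ} ⟨⟨?_, fun a => ⟨Set.univ, by simp, by simp⟩⟩, ?_⟩
  · simp [Set.empty_ne_univ]
  · rintro P rfl s
    simpa using τ.r_infinite s

end ConstructionScheme

theorem mainTheorem1 :
    (ConstructionScheme.Diamond → ConstructionScheme.FCA) ∧
      (ConstructionScheme.Diamond → ConstructionScheme.FCAPart) :=
  ⟨fun h => h.fcaPart.fca, fun h => h.fcaPart⟩
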